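/- Let $d,m\in\mathbb{N}$, let $A\in\mathbb{R}^{d\times d}$ and $B\in\mathbb{R}^{d\times m}$ satisfy the Kalman rank condition: $\operatorname{rank}[B,AB,\dots,A^{N-1}B]=d$ for some $N\in\mathbb{N}$. Fix $x\in\mathbb{R}^d$. For $\varepsilon>0$ let $(x^\varepsilon_t)_{t\in[0,1]}$ be the diffusion process started from $x$ with generator $\varepsilon\mathcal{L}$, where $$\mathcal{L}=\sum_{j=1}^d (Ax)_j\frac{\partial}{\partial x_j}+\frac12\sum_{j,k=1}^d(BB^*)_{jk}\frac{\partial^2}{\partial x_j\partial x_k},$$ realised as the solution of $\mathrm{d}x^\varepsilon_t=\varepsilon Ax^\varepsilon_t\,\mathrm{d}t+\sqrt{\varepsilon}\,B\,\mathrm{d}W_t$, $x_0^\varepsilon=x$, for a standard Brownian motion $(W_t)_{t\in[0,1]}$ in $\mathbb{R}^m$. For $y\in\mathbb{R}^d$ let $(z^\varepsilon_t(y))_{t\in[0,1]}$ be the process $(x^\varepsilon_t)_{t\in[0,1]}$ conditioned on $x^\varepsilon_1=y$; that is, $y\mapsto\operatorname{Law}(z^\varepsilon(y))$ is the regular conditional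 distribution of $x^\varepsilon$ given $x_1^\varepsilon$ on $C([0,1],\mathbb{R}^d)$ which is weakly continuous in $y$ (it exists and is unique). Set $$\Gamma_t^\varepsilon=\int_0^t e^{-\varepsilon sA}BB^*e^{-\varepsilon sA^*}\,\mathrm{d}s,\qquad \phi_t^\varepsilon(y)=e^{\varepsilon tA}x+e^{\varepsilon tA}\Gamma^\varepsilon_t(\Gamma^\varepsilon_1)^{-1}(e^{-\varepsilon A}y-x),$$ where $\Gamma_1^\varepsilon$ is invertible for every $\varepsilon>0$, and let $\Omega^{0,0}=\{\omega\in C([0,1],\mathbb{R}^d):\omega_0=0,\ \omega_1=0\}$ with the topology of uniform convergence. Then, for all $x,y\in\mathbb{R}^d$, the processes $(z^\varepsilon_t(y)-\phi^\varepsilon_t(y))_{t\in[0,1]}$ have laws supported on $\Omega^{0,0}$, and they converge weakly on $\Omega^{0,0}$ to the zero process as $\varepsilon\to0$. -/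

import Mathlib

open MeasureTheory ProbabilityTheory Filter Topology
open scoped unitInterval BoundedContinuousFunction

noncomputable section

namespace DiffusionBridge

/-! ### Path spaces -/

/-- Continuous paths `[0,1] → ℝ^d`, with the topology of uniform convergence. -/
abbrev PathSpace (d : ℕ) : Type := C(I, EuclideanSpace ℝ (Fin d))

instance instMeasurableSpacePathSpace (d : ℕ) : MeasurableSpace (PathSpace d) := borel _

instance instBorelSpacePathSpace (d : ℕ) : BorelSpace (PathSpace d) := ⟨rfl⟩

/-- The space `Ω^{0,0}` of continuous loops in `ℝ^d` based at the origin, as a subspace of the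
space of continuous paths. -/
abbrev LoopSpace (d : ℕ) : Type := {w : PathSpace d // w 0 = 0 ∧ w 1 = 0}

/-- The constant loop at the origin. -/
def zeroLoop (d : ℕ) : LoopSpace d := ⟨0, rfl, rfl⟩

/-! ### The Kalman rank condition -/

/-- The block matrix `[B, AB, A²B, …, A^{N-1}B]`; its columns are indexed by pairs
(block, column in the block). -/
def kalmanMatrix {d m : ℕ} (A : Matrix (Fin d) (Fin d) ℝ) (B : Matrix (Fin d) (Fin m) ℝ) (N : ℕ) :
    Matrix (Fin d) (Fin N × Fin m) ℝ :=
  Matrix.of fun i p => (A ^ (p.1 : ℕ) * B) i p.2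

/-- The Kalman rank condition. -/
def KalmanCondition {d m : ℕ} (A : Matrix (Fin d) (Fin d) ℝ) (B : Matrix (Fin d) (Fin m) ℝ) :
    Prop :=
  ∃ N : ℕ, (kalmanMatrix A B N).rank = d

/-! ### Brownian motion and the diffusion -/

/-- `W` is a standard Brownian motion in `ℝ^m` with time set `[0,1]`: it starts from `0`, has
independent increments, `W_t - W_s` is centred Gaussian with covariance `(t - s) Id`, and its
paths are continuous (almost surely). -/
structure IsBrownianMotion {Ω : Type*} [MeasurableSpace Ω] {m : ℕ}
    (W : I → Ω → EuclideanSpace ℝ (Fin m)) (P : Measure Ω) : Prop where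
  start : ∀ᵐ ω ∂P, W 0 ω = 0
  indep : HasIndepIncrements W P
  law : ∀ s t : I, s ≤ t →
    HasLaw (fun ω => W t ω - W s ω)
      (multivariateGaussian 0 (((t : ℝ) - (s : ℝ)) • (1 : Matrix (Fin m) (Fin m) ℝ))) P
  cont : ∀ᵐ ω ∂P, Continuous fun t => W t ω

/-- The process `X` is the diffusion started from `x` with generator
`ε (∑ⱼ (A x)ⱼ ∂ⱼ + ½ ∑ⱼₖ (B Bᵀ)ⱼₖ ∂ⱼ∂ₖ)`, realised as the solution of
`dX_t = ε A X_t dt + √ε B dW_t`, `X_0 = x`, driven by `W`. As the coefficient of the noise is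
constant and `W_0 = 0`, the stochastic integral `∫₀ᵗ √ε B dW_s` is `√ε B W_t`. -/
structure IsDiffusion {Ω : Type*} [MeasurableSpace Ω] {d m : ℕ}
    (A : Matrix (Fin d) (Fin d) ℝ) (B : Matrix (Fin d) (Fin m) ℝ) (ε : ℝ)
    (x : EuclideanSpace ℝ (Fin d)) (W : I → Ω → EuclideanSpace ℝ (Fin m)) (P : Measure Ω)
    (X : Ω → PathSpace d) : Prop where
  aemeasurable : AEMeasurable X P
  sde : ∀ᵐ ω ∂P, ∀ t : I,
    X ω t = x
      + (∫ s in (0 : ℝ)..(t : ℝ),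
          ε • Matrix.toEuclideanLin A (X ω (Set.projIcc 0 1 zero_le_one s)))
      + Real.sqrt ε • Matrix.toEuclideanLin B (W t ω)

/-! ### Conditioning on the final position -/

/-- `κ y` is, for every `y`, the law of the process `X` conditioned on `X_1 = y`: the kernel `κ` is
a regular conditional distribution of `X` given `X_1`, in the version which depends on `y`
continuously for weak convergence. (The event `X_1 = y` may be null, and a regular conditional
distribution alone is only determined for almost every `y`.) -/
structure IsBridge {Ω : Type*} [MeasurableSpace Ω] {d : ℕ} (X : Ω → PathSpace d) (P : Measure Ω)
    (κ : Kernel (EuclideanSpace ℝ (Fin d)) (PathSpace d)) : Prop where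
  markov : IsMarkovKernel κ
  cond : HasCondDistrib X (fun ω => X ω 1) κ P
  cont : ∀ f : PathSpace d →ᵇ ℝ, Continuous fun y => ∫ w, f w ∂(κ y)

/-! ### The deterministic path -/

/-- `Γ_t^ε = ∫₀ᵗ e^{-εsA} B Bᵀ e^{-εsAᵀ} ds`, with the integral taken entrywise. -/
def Gam {d m : ℕ} (A : Matrix (Fin d) (Fin d) ℝ) (B : Matrix (Fin d) (Fin m) ℝ) (ε t : ℝ) :
    Matrix (Fin d) (Fin d) ℝ :=
  Matrix.of fun i j => ∫ s in (0 : ℝ)..t,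
    (NormedSpace.exp ((-(ε * s)) • A) * (B * B.transpose)
      * NormedSpace.exp ((-(ε * s)) • A.transpose)) i j

theorem continuous_exp_smul {d : ℕ} (A : Matrix (Fin d) (Fin d) ℝ) {f : ℝ → ℝ}
    (hf : Continuous f) : Continuous fun s => NormedSpace.exp (f s • A) := by
  let _ : NormedRing (Matrix (Fin d) (Fin d) ℝ) := Matrix.linftyOpNormedRing
  let _ : NormedAlgebra ℝ (Matrix (Fin d) (Fin d) ℝ) := Matrix.linftyOpNormedAlgebra
  let _ : NormedAlgebra ℚ (Matrix (Fin d) (Fin d) ℝ) := NormedAlgebra.restrictScalars ℚ ℝ _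
  have h : Continuous (NormedSpace.exp : Matrix (Fin d) (Fin d) ℝ → _) :=
    NormedSpace.exp_continuous
  exact h.comp (hf.smul continuous_const)

theorem continuous_Gam {d m : ℕ} (A : Matrix (Fin d) (Fin d) ℝ) (B : Matrix (Fin d) (Fin m) ℝ)
    (ε : ℝ) : Continuous fun t => Gam A B ε t := by
  refine continuous_matrix fun i j => ?_
  have h : Continuous fun s : ℝ => (NormedSpace.exp ((-(ε * s)) • A) * (B * B.transpose)
      * NormedSpace.exp ((-(ε * s)) • A.transpose)) :=
    ((continuous_exp_smul A (by fun_prop)).matrix_mul continuous_const).matrix_mul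
      (continuous_exp_smul A.transpose (by fun_prop))
  exact intervalIntegral.continuous_primitive
    (fun a b => (h.matrix_elem i j).intervalIntegrable a b) 0

theorem continuous_toEuclideanLin {d : ℕ} {M : ℝ → Matrix (Fin d) (Fin d) ℝ} (hM : Continuous M)
    (v : EuclideanSpace ℝ (Fin d)) : Continuous fun t => Matrix.toEuclideanLin (M t) v := by
  refine (PiLp.continuous_toLp 2 _).comp ?_
  exact hM.matrix_mulVec continuous_const

/-- The path `φ_t^ε(y) = e^{εtA} x + e^{εtA} Γ_t^ε (Γ_1^ε)⁻¹ (e^{-εA} y - x)`. -/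
def phi {d m : ℕ} (A : Matrix (Fin d) (Fin d) ℝ) (B : Matrix (Fin d) (Fin m) ℝ) (ε : ℝ)
    (x y : EuclideanSpace ℝ (Fin d)) : PathSpace d where
  toFun t :=
    Matrix.toEuclideanLin (NormedSpace.exp ((ε * (t : ℝ)) • A)) x
      + Matrix.toEuclideanLin
          (NormedSpace.exp ((ε * (t : ℝ)) • A) * Gam A B ε (t : ℝ) * (Gam A B ε 1)⁻¹)
          (Matrix.toEuclideanLin (NormedSpace.exp ((-ε) • A)) y - x)
  continuous_toFun := by
    have h := continuous_exp_smul A (f := fun t => ε * t) (by fun_prop)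
    exact ((continuous_toEuclideanLin h x).add
      (continuous_toEuclideanLin
        ((h.matrix_mul (continuous_Gam A B ε)).matrix_mul continuous_const) _)).comp
      continuous_subtype_val

end DiffusionBridge

end

noncomputable section

namespace DiffusionBridge

open ContinuousLinearMap (adjoint)

/-! ### Integrals of smooth functions against Brownian motion -/

/-! Put `N_t = e^{-εtA} X_t - x`. Variation of constants gives `N_t = √ε ∫₀ᵗ e^{-εsA} B dW_s`, a
centred Gaussian process with covariance `ε Γ_{min(s,t)}`. The residual `R = X - φ(X_1)` equals
`e^{εtA} (N_t - Γ_t Γ_1⁻¹ N_1)`, which is uncorrelated with `N_1`, hence independent of it and of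
`X_1` (`IsDiffusion.indepFun_noise_residual`). As `X = R + φ(X_1)`, the law of `R + φ(y)` is a
weakly continuous version of the conditional law, and the only one because `X_1` has full support
(`IsDiffusion.isBridge_iff`). So `z(y) - φ(y)` has the law of `R`, whatever `y` is.

It remains to see that `R → 0` in probability. A direct estimate would need control of `Γ_t Γ_1⁻¹`,
although `Γ_1` tends to `B Bᵀ`, which may be singular. Instead, `D_t = X_t - e^{εtA} x` is `R` plus
an odd function of `N_1`, and `N_1` is symmetric and independent of `R`; hence `P(‖R‖ ≥ δ) ≤ 2 P(‖D‖
≥ δ)` (`measure_le_norm_le_two_mul`). Since `D_t = e^{εtA} N_t` is pathwise of order `√ε`, this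
suffices.

No stochastic calculus is needed: the integrands are smooth, so the integrals are defined path by
path through integration by parts, and their Gaussian laws come from limits of sums over increments
(`IsBrownianMotion.charFun_pathIntegral`). -/

/-- The increments of `G` telescope to `G (⌈nt⌉ / n)`, and at most `n` errors of size `δ / n` are
added. Cutting off by `k / n < t`, rather than subdividing `[0,t]`, lets several times `t` share one
mesh. -/
theorem tendsto_sum_of_increments {a : ℕ → ℕ → ℝ} {G : ℝ → ℝ} (hG : Continuous G) (hG0 : G 0 = 0)
    {t : ℝ} (ht0 : 0 ≤ t) (ht1 : t ≤ 1)
    (h : ∀ δ > 0, ∀ᶠ n : ℕ in atTop, ∀ k < n,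
      |a n k - (G ((k + 1 : ℕ) / n) - G (k / n))| ≤ δ / n) :
    Tendsto (fun n : ℕ => ∑ k ∈ Finset.range n, if (k / n : ℝ) < t then a n k else 0) atTop
      (𝓝 (G t)) := by
  have hlim : Tendsto (fun n : ℕ => G (⌈(n : ℝ) * t⌉₊ / (n : ℝ))) atTop (𝓝 (G t)) := by
    refine (hG.tendsto t).comp ?_
    have := (tendsto_nat_ceil_mul_div_atTop ht0).comp (tendsto_natCast_atTop_atTop (R := ℝ))
    refine this.congr fun n => ?_
    simp [mul_comm]
  have hsum : ∀ n : ℕ, 0 < n → (∑ k ∈ Finset.range n, if (k / n : ℝ) < t then a n k else 0)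
      - G (⌈(n : ℝ) * t⌉₊ / (n : ℝ))
      = ∑ k ∈ Finset.range ⌈(n : ℝ) * t⌉₊, (a n k - (G ((k + 1 : ℕ) / n) - G (k / n))) := by
    intro n hn
    have hn' : (0 : ℝ) < n := by exact_mod_cast hn
    rw [Finset.sum_sub_distrib, Finset.sum_range_sub (fun k : ℕ => G ((k : ℝ) / n))]
    simp only [Nat.cast_zero, zero_div, hG0, sub_zero]
    congr 1
    rw [← Finset.sum_filter]
    refine Finset.sum_congr ?_ fun _ _ => rfl
    ext k
    simp only [Finset.mem_filter, Finset.mem_range, Nat.lt_ceil, div_lt_iff₀ hn']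
    constructor
    · rintro ⟨-, h⟩
      linarith
    · intro h
      refine ⟨?_, by linarith⟩
      have : (k : ℝ) < n := h.trans_le (by nlinarith)
      exact_mod_cast this
  have hdiff : Tendsto (fun n : ℕ =>
      (∑ k ∈ Finset.range n, if (k / n : ℝ) < t then a n k else 0)
        - G (⌈(n : ℝ) * t⌉₊ / (n : ℝ))) atTop (𝓝 0) := by
    rw [Metric.tendsto_nhds]
    intro δ hδ
    filter_upwards [h (δ / 2) (by positivity), eventually_gt_atTop 0] with n hn hn0
    have hn' : (0 : ℝ) < n := by exact_mod_cast hn0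
    have hle : ⌈(n : ℝ) * t⌉₊ ≤ n := by
      rw [Nat.ceil_le]
      nlinarith
    rw [Real.dist_eq, sub_zero, hsum n hn0]
    refine lt_of_le_of_lt (Finset.abs_sum_le_sum_abs _ _) ?_
    refine lt_of_le_of_lt (Finset.sum_le_sum fun k hk =>
      hn k ((Finset.mem_range.1 hk).trans_le hle)) ?_
    rw [Finset.sum_const, Finset.card_range, nsmul_eq_mul]
    have : (⌈(n : ℝ) * t⌉₊ : ℝ) ≤ n := by exact_mod_cast hle
    calc (⌈(n : ℝ) * t⌉₊ : ℝ) * (δ / 2 / n) ≤ n * (δ / 2 / n) := by gcongr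
      _ = δ / 2 := by field_simp
      _ < δ := by linarith
  simpa using hdiff.add hlim

/-- On a fine uniform mesh, a continuous function varies little on each subinterval of `[0,1]`. -/
theorem eventually_norm_sub_le_of_mesh {F : Type*} [NormedAddCommGroup F] {w : ℝ → F}
    (hw : Continuous w) {δ : ℝ} (hδ : 0 < δ) :
    ∀ᶠ n : ℕ in atTop, ∀ k < n, ∀ r ∈ Set.Icc (k / n : ℝ) ((k + 1 : ℕ) / n),
      ∀ s ∈ Set.Icc (k / n : ℝ) ((k + 1 : ℕ) / n), ‖w r - w s‖ ≤ δ := by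
  have huc : UniformContinuousOn w (Set.Icc 0 1) :=
    isCompact_Icc.uniformContinuousOn_of_continuous hw.continuousOn
  obtain ⟨ρ, hρ, hwρ⟩ := Metric.uniformContinuousOn_iff.1 huc δ hδ
  have hsmall : ∀ᶠ n : ℕ in atTop, 1 / (n : ℝ) < ρ :=
    (tendsto_const_div_atTop_nhds_zero_nat (1 : ℝ)).eventually (gt_mem_nhds hρ)
  filter_upwards [hsmall, eventually_gt_atTop 0] with n hn hn0 k hk r hr s hs
  have hn' : (0 : ℝ) < n := by exact_mod_cast hn0
  have hk0 : (0 : ℝ) ≤ k / n := by positivity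
  have hk1 : ((k + 1 : ℕ) / n : ℝ) ≤ 1 := by
    rw [div_le_one hn']
    exact_mod_cast hk
  have hlen : ((k + 1 : ℕ) / n : ℝ) = k / n + 1 / n := by
    push_cast
    ring
  have := hwρ r ⟨hk0.trans hr.1, hr.2.trans hk1⟩ s ⟨hk0.trans hs.1, hs.2.trans hk1⟩ (by
    rw [Real.dist_eq, abs_lt]
    constructor <;> linarith [hr.1, hr.2, hs.1, hs.2])
  rw [dist_eq_norm] at this
  exact this.le

theorem tendsto_riemann_sum {φ : ℝ → ℝ} (hφ : Continuous φ) {t : ℝ} (ht0 : 0 ≤ t) (ht1 : t ≤ 1) :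
    Tendsto (fun n : ℕ => ∑ k ∈ Finset.range n, if (k / n : ℝ) < t then φ (k / n) / n else 0)
      atTop (𝓝 (∫ s in (0 : ℝ)..t, φ s)) := by
  refine tendsto_sum_of_increments (G := fun t => ∫ s in (0 : ℝ)..t, φ s)
    (intervalIntegral.continuous_primitive (fun a b => hφ.intervalIntegrable a b) 0) (by simp)
    ht0 ht1 fun δ hδ => ?_
  filter_upwards [eventually_norm_sub_le_of_mesh hφ hδ, eventually_gt_atTop 0] with n hn hn0 k hk
  have hn' : (0 : ℝ) < n := by exact_mod_cast hn0
  have hlen : ((k + 1 : ℕ) / n : ℝ) - k / n = 1 / n := by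
    push_cast
    ring
  have hle : (k / n : ℝ) ≤ (k + 1 : ℕ) / n := by
    have : (0 : ℝ) < 1 / n := by positivity
    linarith
  rw [intervalIntegral.integral_interval_sub_left (hφ.intervalIntegrable _ _)
    (hφ.intervalIntegrable _ _)]
  have hconst : φ (k / n) / n = ∫ _ in (k / n : ℝ)..((k + 1 : ℕ) / n), φ (k / n) := by
    rw [intervalIntegral.integral_const, hlen, smul_eq_mul]
    ring
  rw [hconst, ← intervalIntegral.integral_sub intervalIntegrable_const
    (hφ.intervalIntegrable _ _), ← Real.norm_eq_abs]
  refine (intervalIntegral.norm_integral_le_of_norm_le_const (C := δ) fun s hs => ?_).trans ?_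
  · rw [Set.uIoc_of_le hle] at hs
    exact hn k hk _ (Set.left_mem_Icc.2 hle) s ⟨hs.1.le, hs.2⟩
  · rw [hlen, abs_of_pos (by positivity)]
    exact le_of_eq (by ring)

/-- The integral `∫₀ᵗ ⟨f, dw⟩` of a `C¹` function `f` with derivative `f'` against a continuous
path `w` starting at the origin, defined through integration by parts. -/
def pathIntegral {F : Type*} [NormedAddCommGroup F] [InnerProductSpace ℝ F]
    (f f' w : ℝ → F) (t : ℝ) : ℝ :=
  inner ℝ (f t) (w t) - ∫ s in (0 : ℝ)..t, inner ℝ (f' s) (w s)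

/-- On a mesh interval `[p,q]` the error is exactly `∫ ⟨f', w_s - w_q⟩ ds`, so uniform continuity of
`w` is enough and bounded variation plays no role. -/
theorem tendsto_sum_pathIntegral {F : Type*} [NormedAddCommGroup F] [InnerProductSpace ℝ F]
    {f f' w : ℝ → F} (hf : ∀ s, HasDerivAt f (f' s) s) (hf' : Continuous f') (hw : Continuous w)
    (hw0 : w 0 = 0) {t : ℝ} (ht0 : 0 ≤ t) (ht1 : t ≤ 1) :
    Tendsto (fun n : ℕ => ∑ k ∈ Finset.range n, if (k / n : ℝ) < t then
      inner ℝ (f (k / n)) (w ((k + 1 : ℕ) / n) - w (k / n)) else 0) atTop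
      (𝓝 (pathIntegral f f' w t)) := by
  have hfc : Continuous f := continuous_iff_continuousAt.2 fun s => (hf s).continuousAt
  have hint : Continuous fun s => inner ℝ (f' s) (w s) := hf'.inner hw
  have hG : Continuous (pathIntegral f f' w) := (hfc.inner hw).sub
    (intervalIntegral.continuous_primitive (fun a b => hint.intervalIntegrable a b) 0)
  refine tendsto_sum_of_increments hG (by simp [pathIntegral, hw0]) ht0 ht1 fun δ hδ => ?_
  obtain ⟨C, hC⟩ := isCompact_Icc.exists_bound_of_continuousOn (s := Set.Icc (0 : ℝ) 1)
    hf'.continuousOn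
  have hC0 : 0 ≤ C := (norm_nonneg _).trans (hC 0 ⟨le_rfl, zero_le_one⟩)
  -- `C + 1` replaces `C` because the bound on `f'` may be zero.
  filter_upwards [eventually_norm_sub_le_of_mesh hw (δ := δ / (C + 1)) (by positivity),
    eventually_gt_atTop 0] with n hn hn0 k hk
  have hn' : (0 : ℝ) < n := by exact_mod_cast hn0
  set p : ℝ := k / n with hp
  set q : ℝ := (k + 1 : ℕ) / n with hq
  have hlen : q - p = 1 / n := by
    rw [hp, hq]
    push_cast
    ring
  have hle : p ≤ q := by
    have : (0 : ℝ) < 1 / n := by positivity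
    linarith
  have hp0 : 0 ≤ p := by positivity
  have hq1 : q ≤ 1 := by
    rw [hq, div_le_one hn']
    exact_mod_cast hk
  have hfq : inner ℝ (f q) (w q) - inner ℝ (f p) (w q) = ∫ s in p..q, inner ℝ (f' s) (w q) := by
    have hc : Continuous fun s => inner ℝ (f' s) (w q) := hf'.inner continuous_const
    rw [intervalIntegral.integral_eq_sub_of_hasDerivAt (f := fun s => inner ℝ (f s) (w q))
      (fun s _ => ?_) (hc.intervalIntegrable _ _)]
    simpa using (hf s).inner ℝ (hasDerivAt_const s (w q))
  have hc : Continuous fun s => inner ℝ (f' s) (w q) := hf'.inner continuous_const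
  have hkey : inner ℝ (f p) (w q - w p) - (pathIntegral f f' w q - pathIntegral f f' w p)
      = ∫ s in p..q, inner ℝ (f' s) (w s - w q) := by
    simp only [inner_sub_right]
    rw [intervalIntegral.integral_sub (hint.intervalIntegrable _ _) (hc.intervalIntegrable _ _),
      ← hfq, ← intervalIntegral.integral_interval_sub_left (hint.intervalIntegrable 0 q)
        (hint.intervalIntegrable 0 p)]
    simp only [pathIntegral]
    ring
  rw [hkey, ← Real.norm_eq_abs]
  refine (intervalIntegral.norm_integral_le_of_norm_le_const (C := δ) fun s hs => ?_).trans ?_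
  · rw [Set.uIoc_of_le hle] at hs
    calc ‖inner ℝ (f' s) (w s - w q)‖ ≤ ‖f' s‖ * ‖w s - w q‖ := norm_inner_le_norm _ _
      _ ≤ C * (δ / (C + 1)) := by
        gcongr
        · exact hC s ⟨hp0.trans hs.1.le, hs.2.trans hq1⟩
        · exact hn k hk s ⟨hs.1.le, hs.2⟩ q (Set.right_mem_Icc.2 hle)
      _ ≤ δ := by
        rw [mul_div_assoc', div_le_iff₀ (by positivity)]
        nlinarith
  · rw [hlen, abs_of_pos (by positivity)]
    exact le_of_eq (by ring)

/-- Extension to `ℝ` of a path indexed by the unit interval. -/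
def extend {Ω F : Type*} (W : I → Ω → F) (ω : Ω) (s : ℝ) : F := W (Set.projIcc 0 1 zero_le_one s) ω

theorem IsBrownianMotion.charFun_increment {Ω : Type*} [MeasurableSpace Ω] {m : ℕ}
    {P : Measure Ω} {W : I → Ω → EuclideanSpace ℝ (Fin m)}
    (hW : IsBrownianMotion W P) {s t : I} (hst : s ≤ t) (u : EuclideanSpace ℝ (Fin m)) :
    charFun (P.map fun ω => inner ℝ u (W t ω - W s ω)) 1
      = Complex.exp (-((((t : ℝ) - s) * inner ℝ u u / 2 : ℝ) : ℂ)) := by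
  have hpos : ((((t : ℝ) - (s : ℝ)) • (1 : Matrix (Fin m) (Fin m) ℝ))).PosSemidef :=
    Matrix.PosSemidef.one.smul (sub_nonneg.2 hst)
  have hlaw := hW.law s t hst
  have h1 : charFun (P.map fun ω => inner ℝ u (W t ω - W s ω)) 1
      = charFun (P.map fun ω => W t ω - W s ω) u := by
    rw [charFun_apply, charFun_apply, integral_map (by have := hlaw.aemeasurable; fun_prop)
      (by fun_prop), integral_map hlaw.aemeasurable (by fun_prop)]
    simp [real_inner_comm]
  rw [h1, hlaw.map_eq, charFun_multivariateGaussian hpos]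
  congr 1
  simp only [inner_zero_right, Complex.ofReal_zero, zero_mul, zero_sub, Matrix.smul_mulVec,
    Matrix.one_mulVec, dotProduct_smul, smul_eq_mul]
  have hdot : u.ofLp ⬝ᵥ u.ofLp = inner ℝ u u := by
    rw [EuclideanSpace.inner_eq_star_dotProduct]
    simp
  rw [hdot]
  push_cast
  ring

/-- A joint form of the Wiener isometry. For the approximating sums the characteristic function
factorises by independence of increments; the exponents are Riemann sums, and dominated convergence
applies since the integrand has modulus one. -/
theorem IsBrownianMotion.charFun_pathIntegral {Ω : Type*} [MeasurableSpace Ω] {m : ℕ}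
    {P : Measure Ω} [IsProbabilityMeasure P] {W : I → Ω → EuclideanSpace ℝ (Fin m)}
    (hW : IsBrownianMotion W P) {ι : Type*} [Fintype ι] {t : ι → ℝ} (ht0 : ∀ j, 0 ≤ t j)
    (ht1 : ∀ j, t j ≤ 1) {f f' : ι → ℝ → EuclideanSpace ℝ (Fin m)}
    (hf : ∀ j s, HasDerivAt (f j) (f' j s) s) (hf' : ∀ j, Continuous (f' j)) :
    ∫ ω, Complex.exp (((∑ j, pathIntegral (f j) (f' j) (extend W ω) (t j) : ℝ) : ℂ) * Complex.I) ∂P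
      = Complex.exp (-(((∑ j, ∑ l, ∫ s in (0 : ℝ)..min (t j) (t l), inner ℝ (f j s) (f l s)) / 2
        : ℝ) : ℂ)) := by
  have hfc : ∀ j, Continuous (f j) := fun j =>
    continuous_iff_continuousAt.2 fun s => (hf j s).continuousAt
  let τ : ℕ → ℕ → I := fun n k => Set.projIcc 0 1 zero_le_one ((k : ℝ) / n)
  have hτ : ∀ n, Monotone (τ n) := fun n k l hkl => Set.monotone_projIcc _ (by gcongr)
  have hτv : ∀ n k : ℕ, 0 < n → k ≤ n → ((τ n k : I) : ℝ) = k / n := fun n k hn hk => by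
    have hn' : (0 : ℝ) < n := by exact_mod_cast hn
    have : (k / n : ℝ) ≤ 1 := by
      rw [div_le_one hn']
      exact_mod_cast hk
    simp only [τ]
    rw [Set.projIcc_of_mem zero_le_one ⟨by positivity, this⟩]
  -- All the integrals are merged into one, with integrand `∑ j, 1_{s < t j} f j`; in `⟨h, h⟩` the
  -- products of indicators produce the upper limits `min (t j) (t l)`.
  let h : ℝ → EuclideanSpace ℝ (Fin m) := fun s => ∑ j, if s < t j then f j s else 0
  let S : ℕ → Ω → ℝ := fun n ω =>
    ∑ k ∈ Finset.range n, inner ℝ (h (k / n)) (W (τ n (k + 1)) ω - W (τ n k) ω)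
  have hmeas : ∀ n k, AEMeasurable (fun ω => W (τ n (k + 1)) ω - W (τ n k) ω) P := fun n k =>
    (hW.law _ _ (hτ n (Nat.le_succ k))).aemeasurable
  have hSm : ∀ n, AEMeasurable (S n) P := fun n =>
    Finset.aemeasurable_fun_sum _ fun k _ => by
      have := hmeas n k
      fun_prop
  have hScf : ∀ n : ℕ, 0 < n → ∫ ω, Complex.exp ((S n ω : ℂ) * Complex.I) ∂P
      = Complex.exp (-(((∑ k ∈ Finset.range n, inner ℝ (h (k / n)) (h (k / n)) / n) / 2
        : ℝ) : ℂ)) := by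
    intro n hn
    have hn' : (0 : ℝ) < n := by exact_mod_cast hn
    have hind : iIndepFun (fun (k : ℕ) ω =>
        inner ℝ (h (k / n)) (W (τ n (k + 1)) ω - W (τ n k) ω)) P :=
      (hW.indep.nat (hτ n)).comp (fun (k : ℕ) v => inner ℝ (h (k / n)) v) fun k => by fun_prop
    have hprod := (hind.restrict (Finset.range n)).charFun_map_fun_finsetSum_eq_prod
      (fun k _ => by have := hmeas n k; fun_prop)
    have h1 : charFun (P.map (S n)) 1 = ∫ ω, Complex.exp ((S n ω : ℂ) * Complex.I) ∂P := by
      rw [charFun_apply, integral_map (hSm n) (by fun_prop)]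
      simp
    rw [← h1]
    have h2 := congrFun hprod 1
    simp only [Finset.prod_apply] at h2
    rw [show P.map (S n) = P.map (fun ω => ∑ k ∈ Finset.range n,
      inner ℝ (h (k / n)) (W (τ n (k + 1)) ω - W (τ n k) ω)) from rfl, h2,
      Finset.prod_congr rfl fun k _ => hW.charFun_increment (hτ n (Nat.le_succ k)) (h (k / n)),
      ← Complex.exp_sum]
    congr 1
    rw [Finset.sum_neg_distrib, ← Complex.ofReal_sum, Finset.sum_div]
    congr 2
    refine Finset.sum_congr rfl fun k hk => ?_
    rw [hτv n k hn (Finset.mem_range.1 hk).le, hτv n (k + 1) hn (Finset.mem_range.1 hk)]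
    push_cast
    ring
  have hSlim : ∀ᵐ ω ∂P, Tendsto (fun n => S n ω) atTop
      (𝓝 (∑ j, pathIntegral (f j) (f' j) (extend W ω) (t j))) := by
    filter_upwards [hW.cont, hW.start] with ω hωc hω0
    have hwc : Continuous (extend W ω) := hωc.comp continuous_projIcc
    have hw0 : extend W ω 0 = 0 := by
      simp only [extend, Set.projIcc_left]
      exact hω0
    refine (tendsto_finsetSum Finset.univ fun j _ =>
      tendsto_sum_pathIntegral (hf j) (hf' j) hwc hw0 (ht0 j) (ht1 j)).congr fun n => ?_
    rw [Finset.sum_comm]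
    refine Finset.sum_congr rfl fun k _ => ?_
    simp only [h, sum_inner, τ, extend]
    refine Finset.sum_congr rfl fun j _ => ?_
    split_ifs <;> simp
  have hlim1 : Tendsto (fun n => ∫ ω, Complex.exp ((S n ω : ℂ) * Complex.I) ∂P) atTop
      (𝓝 (∫ ω, Complex.exp
        (((∑ j, pathIntegral (f j) (f' j) (extend W ω) (t j) : ℝ) : ℂ) * Complex.I) ∂P)) := by
    refine tendsto_integral_of_dominated_convergence (fun _ => 1) (fun n => ?_)
      (integrable_const _) (fun n => ae_of_all _ fun ω => ?_) ?_
    · have := hSm n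
      exact AEMeasurable.aestronglyMeasurable (by fun_prop)
    · rw [Complex.norm_exp_ofReal_mul_I]
    · filter_upwards [hSlim] with ω hω
      exact ((by fun_prop :
        Continuous fun r : ℝ => Complex.exp ((r : ℂ) * Complex.I)).tendsto _).comp hω
  have hlim2 : Tendsto (fun n : ℕ =>
      ∑ k ∈ Finset.range n, inner ℝ (h (k / n)) (h (k / n)) / n) atTop
      (𝓝 (∑ j, ∑ l, ∫ s in (0 : ℝ)..min (t j) (t l), inner ℝ (f j s) (f l s))) := by
    refine (tendsto_finsetSum Finset.univ fun j _ => tendsto_finsetSum Finset.univ fun l _ =>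
      tendsto_riemann_sum ((hfc j).inner (hfc l)) (le_min (ht0 j) (ht0 l))
        ((min_le_left _ _).trans (ht1 j))).congr fun n => ?_
    simp_rw [fun j => Finset.sum_comm (s := (Finset.univ : Finset ι)) (t := Finset.range n)
      (f := fun l k => if (k / n : ℝ) < min (t j) (t l) then
        inner ℝ (f j (k / n)) (f l (k / n)) / (n : ℝ) else 0)]
    rw [Finset.sum_comm]
    refine Finset.sum_congr rfl fun k _ => ?_
    simp only [h, sum_inner, inner_sum, Finset.sum_div]
    refine Finset.sum_congr rfl fun j _ => Finset.sum_congr rfl fun l _ => ?_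
    by_cases h1 : (k / n : ℝ) < t j <;> by_cases h2 : (k / n : ℝ) < t l <;>
      simp [h1, h2, real_inner_comm]
  refine tendsto_nhds_unique hlim1 (Tendsto.congr' ?_
    (((by fun_prop : Continuous fun r : ℝ => Complex.exp (-((r / 2 : ℝ) : ℂ))).tendsto _).comp
      hlim2))
  filter_upwards [eventually_gt_atTop 0] with n hn
  exact (hScf n hn).symm

/-! ### Linear flows and variation of constants -/

/-- The flow `e^{ra}` of a bounded operator. -/
def flow {E : Type*} [NormedAddCommGroup E] [NormedSpace ℝ E] (a : E →L[ℝ] E) (r : ℝ) :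
    E →L[ℝ] E := NormedSpace.exp (r • a)

theorem flow_zero {E : Type*} [NormedAddCommGroup E] [NormedSpace ℝ E] (a : E →L[ℝ] E) :
    flow a 0 = 1 := by simp [flow]

section Hilbert

variable {E F : Type*} [NormedAddCommGroup E] [InnerProductSpace ℝ E] [CompleteSpace E]
  [NormedAddCommGroup F] [InnerProductSpace ℝ F] [CompleteSpace F]

theorem hasDerivAt_flow (a : E →L[ℝ] E) (r : ℝ) : HasDerivAt (flow a) (a * flow a r) r :=
  hasDerivAt_exp_smul_const' a r

theorem continuous_flow (a : E →L[ℝ] E) : Continuous (flow a) :=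
  continuous_iff_continuousAt.2 fun r => (hasDerivAt_flow a r).continuousAt

theorem flow_add (a : E →L[ℝ] E) (r s : ℝ) : flow a (r + s) = flow a r * flow a s := by
  rw [flow, add_smul]
  exact NormedSpace.exp_add_of_commute_of_mem_ball (𝕂 := ℝ)
    (((Commute.refl a).smul_left r).smul_right s)
    (by simp [NormedSpace.expSeries_radius_eq_top]) (by simp [NormedSpace.expSeries_radius_eq_top])

theorem flow_apply_flow_neg (a : E →L[ℝ] E) (r : ℝ) (v : E) : flow a r (flow a (-r) v) = v := by
  have := flow_add a r (-r)
  rw [add_neg_cancel, flow_zero] at this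
  exact (congrArg (fun T : E →L[ℝ] E => T v) this).symm

theorem flow_neg_apply_flow (a : E →L[ℝ] E) (r : ℝ) (v : E) : flow a (-r) (flow a r v) = v := by
  simpa using flow_apply_flow_neg a (-r) v

theorem adjoint_flow (a : E →L[ℝ] E) (r : ℝ) : adjoint (flow a r) = flow (adjoint a) r := by
  rw [← ContinuousLinearMap.star_eq_adjoint, ← ContinuousLinearMap.star_eq_adjoint, flow, flow,
    NormedSpace.star_exp, star_smul]
  simp

theorem hasDerivAt_flow_apply (a : E →L[ℝ] E) (c s : ℝ) (u : E) :
    HasDerivAt (fun s => flow a (c * s) u) (c • a (flow a (c * s) u)) s := by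
  have h1 : HasDerivAt (fun s : ℝ => c * s) c s := by simpa using (hasDerivAt_id s).const_mul c
  have h2 := (hasDerivAt_flow a (c * s)).scomp s h1
  simpa using h2.clm_apply (hasDerivAt_const s u)

theorem continuous_flow_apply (a : E →L[ℝ] E) (c : ℝ) (u : E) :
    Continuous fun s => flow a (c * s) u :=
  continuous_iff_continuousAt.2 fun s => (hasDerivAt_flow_apply a c s u).continuousAt

/-- The curve `s ↦ b† e^{-εsa†} u`. -/
def kernelCurve (a : E →L[ℝ] E) (b : F →L[ℝ] E) (ε : ℝ) (u : E) (s : ℝ) : F :=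
  adjoint b (flow (adjoint a) (-ε * s) u)

/-- The derivative of `kernelCurve`. -/
def kernelCurveDeriv (a : E →L[ℝ] E) (b : F →L[ℝ] E) (ε : ℝ) (u : E) (s : ℝ) : F :=
  (-ε) • adjoint b (adjoint a (flow (adjoint a) (-ε * s) u))

theorem hasDerivAt_kernelCurve (a : E →L[ℝ] E) (b : F →L[ℝ] E) (ε : ℝ) (u : E) (s : ℝ) :
    HasDerivAt (kernelCurve a b ε u) (kernelCurveDeriv a b ε u s) s := by
  have := (adjoint b).hasFDerivAt.comp_hasDerivAt s
    (hasDerivAt_flow_apply (adjoint a) (-ε) s u)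
  rwa [map_smul] at this

theorem continuous_kernelCurve (a : E →L[ℝ] E) (b : F →L[ℝ] E) (ε : ℝ) (u : E) :
    Continuous (kernelCurve a b ε u) :=
  (adjoint b).continuous.comp (continuous_flow_apply _ _ _)

theorem continuous_kernelCurveDeriv (a : E →L[ℝ] E) (b : F →L[ℝ] E) (ε : ℝ) (u : E) :
    Continuous (kernelCurveDeriv a b ε u) :=
  ((adjoint b).continuous.comp
    ((adjoint a).continuous.comp (continuous_flow_apply _ _ _))).const_smul _

/-- Variation of constants for `dX = ε a X dt + c b dw`. -/
theorem inner_flow_neg_sub_eq_pathIntegral {a : E →L[ℝ] E} {b : F →L[ℝ] E} {ε c : ℝ} {x : E}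
    {X : ℝ → E} {w : ℝ → F} (hX : Continuous X)
    (hsde : ∀ t ∈ Set.Icc (0 : ℝ) 1, X t = x + (∫ s in (0 : ℝ)..t, ε • a (X s)) + c • b (w t))
    {t : ℝ} (ht : t ∈ Set.Icc (0 : ℝ) 1) (u : E) :
    inner ℝ (flow a (-ε * t) (X t) - x) u
      = c * pathIntegral (kernelCurve a b ε u) (kernelCurveDeriv a b ε u) w t := by
  -- `X` need not be differentiable, but its drift part `U` is `C¹`, so the product rule is applied
  -- to `⟨U s, e^{-εsa†} u⟩`. The terms in `U` cancel in the derivative and only the noise `c b w`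
  -- survives.
  set U : ℝ → E := fun t => x + ∫ s in (0 : ℝ)..t, ε • a (X s) with hU
  have hcont : Continuous fun s => ε • a (X s) := (a.continuous.comp hX).const_smul ε
  have hUd : ∀ s, HasDerivAt U (ε • a (X s)) s := fun s =>
    (hcont.integral_hasStrictDerivAt 0 s).hasDerivAt.const_add x
  set e : ℝ → E := fun s => flow (adjoint a) (-ε * s) u with he
  have hec : Continuous e := continuous_flow_apply _ _ _
  have hUc : Continuous U := continuous_iff_continuousAt.2 fun s => (hUd s).continuousAt
  have hder : ∀ s, HasDerivAt (fun s => inner ℝ (U s) (e s))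
      (inner ℝ (U s) ((-ε) • adjoint a (e s)) + inner ℝ (ε • a (X s)) (e s)) s := fun s =>
    (hUd s).inner ℝ (hasDerivAt_flow_apply (adjoint a) (-ε) s u)
  have hFTC := intervalIntegral.integral_eq_sub_of_hasDerivAt (a := 0) (b := t)
    (fun s _ => hder s) (by
      refine Continuous.intervalIntegrable ?_ _ _
      exact (hUc.inner (((adjoint a).continuous.comp hec).const_smul _)).add (hcont.inner hec))
  have hcongr : (∫ s in (0 : ℝ)..t,
      (inner ℝ (U s) ((-ε) • adjoint a (e s)) + inner ℝ (ε • a (X s)) (e s)))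
      = ∫ s in (0 : ℝ)..t, (-c) * inner ℝ (kernelCurveDeriv a b ε u s) (w s) := by
    refine intervalIntegral.integral_congr fun s hs => ?_
    rw [Set.uIcc_of_le ht.1] at hs
    have hs1 := hsde s ⟨hs.1, hs.2.trans ht.2⟩
    have hXU : X s = U s + c • b (w s) := hs1
    simp only [hXU, kernelCurveDeriv, map_add, map_smul, inner_smul_left, inner_smul_right,
      inner_add_left, smul_add, ContinuousLinearMap.adjoint_inner_right,
      ContinuousLinearMap.adjoint_inner_left, RCLike.conj_to_real]
    rw [real_inner_comm (a (b (w s)))]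
    ring
  rw [hcongr, intervalIntegral.integral_const_mul] at hFTC
  have hU0 : U 0 = x := by simp [hU]
  have he0 : e 0 = u := by simp [he, flow_zero]
  have hXt : X t = U t + c • b (w t) := hsde t ht
  have hadj : inner ℝ (flow a (-ε * t) (X t)) u = inner ℝ (X t) (e t) := by
    rw [he, ← ContinuousLinearMap.adjoint_inner_right, adjoint_flow]
  rw [inner_sub_left, hadj, hXt, inner_add_left, pathIntegral]
  simp only [hU0, he0] at hFTC
  have hk : inner ℝ (kernelCurve a b ε u t) (w t) = inner ℝ (b (w t)) (e t) := by
    rw [kernelCurve, ContinuousLinearMap.adjoint_inner_left, real_inner_comm]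
  rw [hk, inner_smul_left, RCLike.conj_to_real]
  linarith

/-- On `[0,1]`, the stochastic integrals of the kernel curves are bounded by the noise, uniformly
in `ε ≤ 1`. -/
theorem exists_abs_pathIntegral_kernelCurve_le (a : E →L[ℝ] E) (b : F →L[ℝ] E) :
    ∃ C : ℝ, 0 ≤ C ∧ ∀ ε : ℝ, 0 ≤ ε → ε ≤ 1 → ∀ (u : E) (w : ℝ → F) (S : ℝ),
      (∀ s ∈ Set.Icc (0 : ℝ) 1, ‖w s‖ ≤ S) → ∀ t ∈ Set.Icc (0 : ℝ) 1,
        |pathIntegral (kernelCurve a b ε u) (kernelCurveDeriv a b ε u) w t| ≤ C * S * ‖u‖ := by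
  -- The exponent `-ε s` stays in `[-1,0]` for `ε, s ∈ [0,1]`, which makes the constant independent
  -- of `ε`.
  obtain ⟨K, hK⟩ := isCompact_Icc.exists_bound_of_continuousOn (s := Set.Icc (-1 : ℝ) 0)
    (continuous_flow (adjoint a)).continuousOn
  have hK0 : 0 ≤ K := (norm_nonneg _).trans (hK 0 (by norm_num))
  refine ⟨‖adjoint b‖ * K + ‖adjoint b‖ * (‖adjoint a‖ * K), by positivity,
    fun ε hε0 hε1 u w S hS t ht => ?_⟩
  have hS0 : 0 ≤ S := (norm_nonneg _).trans (hS 0 (by norm_num))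
  have hmem : ∀ s ∈ Set.Icc (0 : ℝ) 1, -ε * s ∈ Set.Icc (-1 : ℝ) 0 := fun s hs =>
    ⟨by nlinarith [hs.1, hs.2], by nlinarith [hs.1, hs.2]⟩
  have hfl : ∀ s ∈ Set.Icc (0 : ℝ) 1, ‖flow (adjoint a) (-ε * s) u‖ ≤ K * ‖u‖ := fun s hs =>
    (ContinuousLinearMap.le_opNorm _ _).trans (by gcongr; exact hK _ (hmem s hs))
  have h1 : ∀ s ∈ Set.Icc (0 : ℝ) 1, ‖kernelCurve a b ε u s‖ ≤ ‖adjoint b‖ * (K * ‖u‖) :=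
    fun s hs => (ContinuousLinearMap.le_opNorm _ _).trans (by gcongr; exact hfl s hs)
  have h2 : ∀ s ∈ Set.Icc (0 : ℝ) 1,
      ‖kernelCurveDeriv a b ε u s‖ ≤ ‖adjoint b‖ * (‖adjoint a‖ * (K * ‖u‖)) := by
    intro s hs
    rw [kernelCurveDeriv, norm_smul, norm_neg, Real.norm_of_nonneg hε0]
    refine (mul_le_of_le_one_left (norm_nonneg _) hε1).trans ?_
    refine (ContinuousLinearMap.le_opNorm _ _).trans ?_
    gcongr
    refine (ContinuousLinearMap.le_opNorm _ _).trans ?_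
    gcongr
    exact hfl s hs
  have h3 : ‖∫ s in (0 : ℝ)..t, inner ℝ (kernelCurveDeriv a b ε u s) (w s)‖
      ≤ ‖adjoint b‖ * (‖adjoint a‖ * (K * ‖u‖)) * S := by
    refine (intervalIntegral.norm_integral_le_of_norm_le_const
      (C := ‖adjoint b‖ * (‖adjoint a‖ * (K * ‖u‖)) * S) fun s hs => ?_).trans ?_
    · rw [Set.uIoc_of_le ht.1] at hs
      have hs' : s ∈ Set.Icc (0 : ℝ) 1 := ⟨hs.1.le, hs.2.trans ht.2⟩
      refine (norm_inner_le_norm _ _).trans ?_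
      gcongr
      · exact h2 s hs'
      · exact hS s hs'
    · rw [sub_zero, abs_of_nonneg ht.1]
      exact mul_le_of_le_one_right (by positivity) ht.2
  have h4 : |inner ℝ (kernelCurve a b ε u t) (w t)| ≤ ‖adjoint b‖ * (K * ‖u‖) * S := by
    refine (abs_real_inner_le_norm _ _).trans ?_
    gcongr
    · exact h1 t ht
    · exact hS t ht
  rw [pathIntegral]
  refine (abs_sub _ _).trans ((add_le_add h4 h3).trans (le_of_eq (by ring)))

end Hilbert

/-! ### Matrices as operators and the Kalman condition -/

/-- A real matrix as a continuous linear map between Euclidean spaces. -/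
def matCLM {k l : ℕ} (M : Matrix (Fin k) (Fin l) ℝ) :
    EuclideanSpace ℝ (Fin l) →L[ℝ] EuclideanSpace ℝ (Fin k) :=
  LinearMap.toContinuousLinearMap (Matrix.toEuclideanLin M)

theorem matCLM_apply {k l : ℕ} (M : Matrix (Fin k) (Fin l) ℝ) (v : EuclideanSpace ℝ (Fin l)) :
    matCLM M v = Matrix.toEuclideanLin M v := rfl

theorem matCLM_mul {j k l : ℕ} (M : Matrix (Fin j) (Fin k) ℝ) (N : Matrix (Fin k) (Fin l) ℝ) :
    matCLM (M * N) = matCLM M ∘L matCLM N := by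
  ext v i
  simp [matCLM_apply, Matrix.toLpLin_apply]

theorem matCLM_transpose {k l : ℕ} (M : Matrix (Fin k) (Fin l) ℝ) :
    matCLM M.transpose = adjoint (matCLM M) := by
  rw [ContinuousLinearMap.eq_adjoint_iff]
  intro v w
  simp only [matCLM_apply, EuclideanSpace.inner_eq_star_dotProduct, Matrix.toLpLin_apply,
    star_trivial]
  rw [Matrix.mulVec_transpose, dotProduct_comm, ← Matrix.dotProduct_mulVec, dotProduct_comm]

theorem matCLM_exp_smul {d : ℕ} (A : Matrix (Fin d) (Fin d) ℝ) (r : ℝ) :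
    matCLM (NormedSpace.exp (r • A)) = flow (matCLM A) r := by
  let _ : NormedRing (Matrix (Fin d) (Fin d) ℝ) := Matrix.linftyOpNormedRing
  let _ : NormedAlgebra ℝ (Matrix (Fin d) (Fin d) ℝ) := Matrix.linftyOpNormedAlgebra
  let _ : NormedAlgebra ℚ (Matrix (Fin d) (Fin d) ℝ) := NormedAlgebra.restrictScalars ℚ ℝ _
  have hc : Continuous (Matrix.toEuclideanCLM (n := Fin d) (𝕜 := ℝ)) :=
    LinearMap.continuous_of_finiteDimensional
      (Matrix.toEuclideanCLM (n := Fin d) (𝕜 := ℝ)).toAlgEquiv.toLinearMap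
  have h := NormedSpace.map_exp (Matrix.toEuclideanCLM (n := Fin d) (𝕜 := ℝ)) hc (r • A)
  rw [map_smul] at h
  exact h

theorem inner_matCLM {k l : ℕ} (M : Matrix (Fin k) (Fin l) ℝ) (u : EuclideanSpace ℝ (Fin k))
    (v : EuclideanSpace ℝ (Fin l)) :
    inner ℝ u (matCLM M v) = ∑ i, ∑ j, u i * (M i j * v j) := by
  simp [matCLM_apply, PiLp.inner_apply, Matrix.toLpLin_apply, Matrix.mulVec, dotProduct,
    Finset.mul_sum, mul_comm, mul_left_comm]

/-- Exhibits `Γ_t` as the Gram form of the kernel curves: its symmetry, positivity and role as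
covariance are all read off from here. -/
theorem inner_matCLM_Gam {d m : ℕ} (A : Matrix (Fin d) (Fin d) ℝ) (B : Matrix (Fin d) (Fin m) ℝ)
    (ε t : ℝ) (u v : EuclideanSpace ℝ (Fin d)) :
    inner ℝ u (matCLM (Gam A B ε t) v) = ∫ s in (0 : ℝ)..t,
      inner ℝ (kernelCurve (matCLM A) (matCLM B) ε u s)
        (kernelCurve (matCLM A) (matCLM B) ε v s) := by
  have hcurve : ∀ s, inner ℝ (kernelCurve (matCLM A) (matCLM B) ε u s)
      (kernelCurve (matCLM A) (matCLM B) ε v s)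
      = ∑ i, ∑ j, u i * ((NormedSpace.exp ((-(ε * s)) • A) * (B * B.transpose)
      * NormedSpace.exp ((-(ε * s)) • A.transpose)) i j * v j) := by
    intro s
    rw [← inner_matCLM, matCLM_mul, matCLM_mul, matCLM_mul, matCLM_exp_smul, matCLM_exp_smul,
      matCLM_transpose, matCLM_transpose, kernelCurve, kernelCurve]
    simp only [ContinuousLinearMap.comp_apply, neg_mul]
    rw [ContinuousLinearMap.adjoint_inner_left, ← adjoint_flow (matCLM A),
      ContinuousLinearMap.adjoint_inner_left]
  have hcont : Continuous fun s : ℝ => (NormedSpace.exp ((-(ε * s)) • A) * (B * B.transpose)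
      * NormedSpace.exp ((-(ε * s)) • A.transpose)) :=
    ((continuous_exp_smul A (by fun_prop)).matrix_mul continuous_const).matrix_mul
      (continuous_exp_smul A.transpose (by fun_prop))
  have hij : ∀ i j, Continuous fun s : ℝ => u i * ((NormedSpace.exp ((-(ε * s)) • A) *
      (B * B.transpose) * NormedSpace.exp ((-(ε * s)) • A.transpose)) i j * v j) := fun i j =>
    continuous_const.mul ((hcont.matrix_elem i j).mul continuous_const)
  simp_rw [hcurve]
  rw [inner_matCLM, intervalIntegral.integral_finsetSum fun i _ =>
    (continuous_finsetSum _ fun j _ => hij i j).intervalIntegrable _ _]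
  refine Finset.sum_congr rfl fun i _ => ?_
  rw [intervalIntegral.integral_finsetSum fun j _ => (hij i j).intervalIntegrable _ _]
  refine Finset.sum_congr rfl fun j _ => ?_
  rw [intervalIntegral.integral_const_mul, intervalIntegral.integral_mul_const]
  rfl

theorem inner_matCLM_Gam_comm {d m : ℕ} (A : Matrix (Fin d) (Fin d) ℝ)
    (B : Matrix (Fin d) (Fin m) ℝ) (ε t : ℝ) (u v : EuclideanSpace ℝ (Fin d)) :
    inner ℝ u (matCLM (Gam A B ε t) v) = inner ℝ v (matCLM (Gam A B ε t) u) := by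
  simp only [inner_matCLM_Gam, real_inner_comm]

/-- Full row rank makes left multiplication of row vectors by the Kalman matrix injective, and the
blocks of `vᵀ [B, AB, …]` are the transposes of `Bᵀ (Aᵀ)ᵏ v`. -/
theorem KalmanCondition.eq_zero {d m : ℕ} {A : Matrix (Fin d) (Fin d) ℝ}
    {B : Matrix (Fin d) (Fin m) ℝ} (hAB : KalmanCondition A B) {v : EuclideanSpace ℝ (Fin d)}
    (hv : ∀ k : ℕ, adjoint (matCLM B) ((adjoint (matCLM A) ^ k) v) = 0) : v = 0 := by
  obtain ⟨N, hN⟩ := hAB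
  have hli : LinearIndependent ℝ (kalmanMatrix A B N).row := by
    rw [linearIndependent_iff_card_eq_finrank_span, Set.finrank,
      ← Matrix.rank_eq_finrank_span_row, hN]
    simp
  have hinj := Matrix.vecMul_injective_iff.2 hli
  have hpow : ∀ k : ℕ, matCLM (A ^ k).transpose = adjoint (matCLM A) ^ k := by
    intro k
    induction k with
    | zero =>
      ext v i
      simp [matCLM_apply]
    | succ k ih =>
      rw [pow_succ, Matrix.transpose_mul, matCLM_mul, ih, matCLM_transpose, pow_succ']
      rfl
  have h0 : Matrix.vecMul v.ofLp (kalmanMatrix A B N) = 0 := by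
    funext p
    have h := hv p.1
    rw [← hpow, ← matCLM_transpose, ← ContinuousLinearMap.comp_apply, ← matCLM_mul,
      ← Matrix.transpose_mul] at h
    have h' := congrArg (fun z : EuclideanSpace ℝ (Fin m) => z.ofLp p.2) h
    simp only [matCLM_apply, Matrix.toLpLin_apply, Matrix.mulVec_transpose] at h'
    simpa [Matrix.vecMul, dotProduct, kalmanMatrix] using h'
  have := hinj (h0.trans (Matrix.zero_vecMul _).symm)
  ext i
  exact congrFun this i

/-- A vector `u` in the kernel satisfies `∫ |Bᵀ e^{-εsAᵀ} u|² ds = 0`, so this curve vanishes on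
`(0,1)` with all its derivatives. The Kalman condition then kills `e^{-εsAᵀ} u`, hence `u`. -/
theorem isUnit_Gam {d m : ℕ} {A : Matrix (Fin d) (Fin d) ℝ} {B : Matrix (Fin d) (Fin m) ℝ}
    (hAB : KalmanCondition A B) {ε : ℝ} (hε : 0 < ε) : IsUnit (Gam A B ε 1) := by
  rw [← Matrix.mulVec_injective_iff_isUnit]
  rw [← Matrix.coe_mulVecLin, ← LinearMap.ker_eq_bot, LinearMap.ker_eq_bot']
  intro u' hu'
  set u : EuclideanSpace ℝ (Fin d) := WithLp.toLp 2 u' with hu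
  have hmat : matCLM (Gam A B ε 1) u = 0 := by
    rw [matCLM_apply, Matrix.toLpLin_apply]
    exact congrArg (WithLp.toLp 2) hu'
  set f := kernelCurve (matCLM A) (matCLM B) ε u with hf
  have hint : ∫ s in (0 : ℝ)..1, inner ℝ (f s) (f s) = 0 := by
    rw [← inner_matCLM_Gam, hmat, inner_zero_right]
  have hfc : Continuous f := continuous_kernelCurve _ _ _ _
  have hzero : ∀ s ∈ Set.Ioo (0 : ℝ) 1, f s = 0 := by
    intro s hs
    by_contra hne
    have hpos : 0 < ∫ s in (0 : ℝ)..1, inner ℝ (f s) (f s) := by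
      refine intervalIntegral.integral_pos zero_lt_one (hfc.inner hfc).continuousOn
        (fun r _ => real_inner_self_nonneg) ⟨s, Set.Ioo_subset_Icc_self hs, ?_⟩
      exact real_inner_self_pos.2 hne
    exact hpos.ne' hint
  have hder : ∀ k : ℕ, ∀ s ∈ Set.Ioo (0 : ℝ) 1, adjoint (matCLM B)
      ((adjoint (matCLM A) ^ k) (flow (adjoint (matCLM A)) (-ε * s) u)) = 0 := by
    intro k
    induction k with
    | zero => exact hzero
    | succ k ih =>
      intro s hs
      have hd := ((adjoint (matCLM B)) ∘L (adjoint (matCLM A) ^ k)).hasFDerivAt.comp_hasDerivAt s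
        (hasDerivAt_flow_apply (adjoint (matCLM A)) (-ε) s u)
      have hd0 : HasDerivAt (((adjoint (matCLM B)) ∘L (adjoint (matCLM A) ^ k)) ∘
          fun s => flow (adjoint (matCLM A)) (-ε * s) u) 0 s :=
        (hasDerivAt_const s (0 : EuclideanSpace ℝ (Fin m))).congr_of_eventuallyEq <| by
          filter_upwards [Ioo_mem_nhds hs.1 hs.2] with r hr
          exact ih r hr
      have := hd.unique hd0
      rw [map_smul, smul_eq_zero] at this
      rw [pow_succ]
      -- Each differentiation brings out a factor `-ε`, which is nonzero.
      exact this.resolve_left (by linarith)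
  have hflow := hAB.eq_zero fun k => hder k (1 / 2) (by norm_num)
  have hu0 : u = 0 := by
    rw [← flow_neg_apply_flow (adjoint (matCLM A)) (-ε * (1 / 2)) u, hflow, map_zero]
  exact congrArg WithLp.ofLp hu0

/-! ### The Borel σ-algebra of the path space -/

/-- By continuity of paths, a closed ball is cut out by conditions at countably many dense times; by
the Lindelöf property, an open set is a countable union of closed balls. Independence of paths thus
reduces to independence of coordinate processes. -/
theorem measurableSpace_pathSpace_eq_comap (d : ℕ) :
    instMeasurableSpacePathSpace d =
      MeasurableSpace.comap (fun (w : PathSpace d) (t : I) => w t) MeasurableSpace.pi := by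
  refine le_antisymm ?_ (Measurable.comap_le (measurable_pi_lambda _ fun t =>
    (continuous_eval_const t).measurable))
  set 𝓜 := MeasurableSpace.comap (fun (w : PathSpace d) (t : I) => w t) MeasurableSpace.pi
  have heval : ∀ t : I, Measurable[𝓜] fun w : PathSpace d => w t := fun t =>
    (measurable_pi_apply t).comp (comap_measurable fun (w : PathSpace d) (t : I) => w t)
  have hclosedBall : ∀ (g : PathSpace d) (r : ℝ), 0 ≤ r →
      MeasurableSet[𝓜] (Metric.closedBall g r) := by
    intro g r hr
    have heq : Metric.closedBall g r
        = ⋂ n : ℕ, {w : PathSpace d | dist (w (TopologicalSpace.denseSeq I n))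
            (g (TopologicalSpace.denseSeq I n)) ≤ r} := by
      ext w
      simp only [Metric.mem_closedBall, Set.mem_iInter, Set.mem_ofPred_eq,
        ContinuousMap.dist_le hr]
      refine ⟨fun h n => h _, fun h => ?_⟩
      have hcl : IsClosed {t : I | dist (w t) (g t) ≤ r} :=
        isClosed_le (w.continuous.dist g.continuous) continuous_const
      have hsub : Set.range (TopologicalSpace.denseSeq I) ⊆ {t : I | dist (w t) (g t) ≤ r} := by
        rintro _ ⟨n, rfl⟩
        exact h n
      have huniv := hcl.closure_subset_iff.2 hsub
      rw [(TopologicalSpace.denseRange_denseSeq I).closure_range] at huniv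
      exact fun t => huniv (Set.mem_univ t)
    rw [heq]
    refine MeasurableSet.iInter fun n => ?_
    have hm : Measurable fun v : EuclideanSpace ℝ (Fin d) =>
        dist v (g (TopologicalSpace.denseSeq I n)) := by fun_prop
    exact measurableSet_le (hm.comp (heval _)) measurable_const
  refine MeasurableSpace.generateFrom_le fun U hU => ?_
  have hU' : IsOpen U := hU
  choose r hr0 hr using fun w : U => Metric.nhds_basis_closedBall.mem_iff.1 (hU'.mem_nhds w.2)
  obtain ⟨T, hT, hTU⟩ := TopologicalSpace.isOpen_iUnion_countable
    (fun w : U => Metric.ball (w : PathSpace d) (r w)) fun w => Metric.isOpen_ball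
  have heq : U = ⋃ w ∈ T, Metric.closedBall (w : PathSpace d) (r w) := by
    refine Set.Subset.antisymm (fun w hw => ?_) (Set.iUnion₂_subset fun w _ => hr w)
    have hmem : w ∈ ⋃ w : U, Metric.ball (w : PathSpace d) (r w) :=
      Set.mem_iUnion.2 ⟨⟨w, hw⟩, Metric.mem_ball_self (hr0 _)⟩
    rw [← hTU] at hmem
    exact Set.iUnion₂_mono (fun _ _ => Metric.ball_subset_closedBall) hmem
  rw [heq]
  exact MeasurableSet.biUnion hT fun w _ => hclosedBall _ _ (hr0 w).le

theorem indepFun_pathSpace_iff {Ω α : Type*} [MeasurableSpace Ω] [MeasurableSpace α] {d : ℕ}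
    {P : Measure Ω} {V : Ω → α} {Z : Ω → PathSpace d} :
    IndepFun V Z P ↔ IndepFun V (fun ω (t : I) => Z ω t) P := by
  rw [IndepFun_iff_Indep, IndepFun_iff_Indep, measurableSpace_pathSpace_eq_comap,
    MeasurableSpace.comap_comp]
  rfl

/-! ### The noise and the residual of a path -/

/-- The path `e^{-εtA} w_t - x`. -/
def noise {d : ℕ} (A : Matrix (Fin d) (Fin d) ℝ) (ε : ℝ) (x : EuclideanSpace ℝ (Fin d))
    (w : PathSpace d) (t : I) : EuclideanSpace ℝ (Fin d) :=
  flow (matCLM A) (-ε * t) (w t) - x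

/-- The path `w - φ^ε(w_1)`. -/
def residual {d m : ℕ} (A : Matrix (Fin d) (Fin d) ℝ) (B : Matrix (Fin d) (Fin m) ℝ) (ε : ℝ)
    (x : EuclideanSpace ℝ (Fin d)) (w : PathSpace d) : PathSpace d :=
  w - phi A B ε x (w 1)

section

variable {d m : ℕ} {A : Matrix (Fin d) (Fin d) ℝ} {B : Matrix (Fin d) (Fin m) ℝ} {ε : ℝ}
  {x : EuclideanSpace ℝ (Fin d)}

theorem phi_apply (A : Matrix (Fin d) (Fin d) ℝ) (B : Matrix (Fin d) (Fin m) ℝ) (ε : ℝ)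
    (x y : EuclideanSpace ℝ (Fin d)) (t : I) :
    phi A B ε x y t = flow (matCLM A) (ε * t)
      (x + matCLM (Gam A B ε t) (matCLM (Gam A B ε 1)⁻¹ (flow (matCLM A) (-ε) y - x))) := by
  rw [map_add]
  change matCLM _ x + matCLM _ (matCLM _ y - x) = _
  rw [matCLM_exp_smul, matCLM_exp_smul, matCLM_mul, matCLM_mul, matCLM_exp_smul]
  rfl

theorem continuous_noise (A : Matrix (Fin d) (Fin d) ℝ) (ε : ℝ) (x : EuclideanSpace ℝ (Fin d))
    (t : I) : Continuous fun w => noise A ε x w t :=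
  ((flow (matCLM A) (-ε * t)).continuous.comp (continuous_eval_const t)).sub
    continuous_const

theorem eval_eq_flow_noise (A : Matrix (Fin d) (Fin d) ℝ) (ε : ℝ)
    (x : EuclideanSpace ℝ (Fin d)) (w : PathSpace d) (t : I) :
    w t = flow (matCLM A) (ε * t) (x + noise A ε x w t) := by
  rw [noise, add_sub_cancel, neg_mul, flow_apply_flow_neg]

theorem noise_one (w : PathSpace d) :
    noise A ε x w 1 = flow (matCLM A) (-ε) (w 1) - x := by
  simp [noise]

theorem residual_apply (A : Matrix (Fin d) (Fin d) ℝ) (B : Matrix (Fin d) (Fin m) ℝ) (ε : ℝ)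
    (x : EuclideanSpace ℝ (Fin d)) (w : PathSpace d) (t : I) :
    residual A B ε x w t = flow (matCLM A) (ε * t)
      (noise A ε x w t - matCLM (Gam A B ε t) (matCLM (Gam A B ε 1)⁻¹ (noise A ε x w 1))) := by
  rw [residual, ContinuousMap.sub_apply, phi_apply, eval_eq_flow_noise A ε x w t, ← map_sub,
    ← noise_one]
  congr 1
  abel

variable {Ω : Type*} [MeasurableSpace Ω] {P : Measure Ω}
  {W : I → Ω → EuclideanSpace ℝ (Fin m)} {X : Ω → PathSpace d}

/-- Variation of constants is applied path by path, so one null set serves all `t` and `u`. -/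
theorem IsDiffusion.inner_noise (hX : IsDiffusion A B ε x W P X) :
    ∀ᵐ ω ∂P, ∀ (t : I) (u : EuclideanSpace ℝ (Fin d)), inner ℝ (noise A ε x (X ω) t) u
      = √ε * pathIntegral (kernelCurve (matCLM A) (matCLM B) ε u)
        (kernelCurveDeriv (matCLM A) (matCLM B) ε u) (extend W ω) t := by
  filter_upwards [hX.sde] with ω hω t u
  have h := inner_flow_neg_sub_eq_pathIntegral (a := matCLM A) (b := matCLM B) (ε := ε) (c := √ε)
    (x := x) (X := fun s => X ω (Set.projIcc 0 1 zero_le_one s)) (w := extend W ω)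
    ((X ω).continuous.comp continuous_projIcc) (fun s hs => by
      simp only [extend]
      rw [Set.projIcc_of_mem zero_le_one hs]
      exact hω ⟨s, hs⟩) t.2 u
  rw [← h, noise, Set.projIcc_val]

theorem pathIntegral_smul {F : Type*} [NormedAddCommGroup F] [InnerProductSpace ℝ F] (c : ℝ)
    (f f' w : ℝ → F) (t : ℝ) :
    pathIntegral (fun s => c • f s) (fun s => c • f' s) w t = c * pathIntegral f f' w t := by
  simp only [pathIntegral, inner_smul_left, RCLike.conj_to_real,
    intervalIntegral.integral_const_mul]
  ring

variable [IsProbabilityMeasure P]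

theorem IsDiffusion.charFun_noise (hW : IsBrownianMotion W P) (hX : IsDiffusion A B ε x W P X)
    (hε : 0 ≤ ε) {ι : Type*} [Fintype ι] (t : ι → I) (u : ι → EuclideanSpace ℝ (Fin d)) :
    ∫ ω, Complex.exp (((∑ j, inner ℝ (noise A ε x (X ω) (t j)) (u j) : ℝ) : ℂ) * Complex.I) ∂P
      = Complex.exp (-((ε / 2 * ∑ j, ∑ l,
        inner ℝ (u j) (matCLM (Gam A B ε (min (t j : ℝ) (t l))) (u l)) : ℝ) : ℂ)) := by
  have h := hW.charFun_pathIntegral (t := fun j => (t j : ℝ)) (fun j => (t j).2.1)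
    (fun j => (t j).2.2)
    (f := fun j s => √ε • kernelCurve (matCLM A) (matCLM B) ε (u j) s)
    (f' := fun j s => √ε • kernelCurveDeriv (matCLM A) (matCLM B) ε (u j) s)
    (fun j s => HasDerivAt.fun_const_smul _ (hasDerivAt_kernelCurve _ _ _ _ _))
    (fun j => by
      have := continuous_kernelCurveDeriv (matCLM A) (matCLM B) ε (u j)
      fun_prop)
  have hae : (fun ω => Complex.exp
      (((∑ j, inner ℝ (noise A ε x (X ω) (t j)) (u j) : ℝ) : ℂ) * Complex.I)) =ᵐ[P]
      fun ω => Complex.exp (((∑ j, pathIntegral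
        (fun s => √ε • kernelCurve (matCLM A) (matCLM B) ε (u j) s)
        (fun s => √ε • kernelCurveDeriv (matCLM A) (matCLM B) ε (u j) s)
        (extend W ω) (t j) : ℝ) : ℂ) * Complex.I) := by
    filter_upwards [hX.inner_noise] with ω hω
    simp only [hω, pathIntegral_smul]
  rw [integral_congr_ae hae, h]
  congr 3
  rw [Finset.mul_sum, Finset.sum_div]
  refine Finset.sum_congr rfl fun j _ => ?_
  rw [Finset.mul_sum, Finset.sum_div]
  refine Finset.sum_congr rfl fun l _ => ?_
  rw [inner_matCLM_Gam]
  simp only [inner_smul_left, inner_smul_right, RCLike.conj_to_real,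
    intervalIntegral.integral_const_mul]
  rw [← mul_assoc, Real.mul_self_sqrt hε]
  ring

theorem IsDiffusion.charFun_noise_one (hW : IsBrownianMotion W P)
    (hX : IsDiffusion A B ε x W P X) (hε : 0 ≤ ε) (u : EuclideanSpace ℝ (Fin d)) :
    charFun (P.map fun ω => noise A ε x (X ω) 1) u
      = Complex.exp (-((ε / 2 * inner ℝ u (matCLM (Gam A B ε 1) u) : ℝ) : ℂ)) := by
  have h := hX.charFun_noise hW hε (fun _ : Unit => (1 : I)) (fun _ => u)
  simp only [Finset.univ_unique, Finset.sum_singleton, Set.Icc.coe_one, min_self] at h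
  have hm : AEMeasurable (fun ω => noise A ε x (X ω) 1) P :=
    (continuous_noise A ε x 1).measurable.comp_aemeasurable hX.aemeasurable
  rw [← h, charFun_apply, integral_map hm (by fun_prop)]

/-- The characteristic function is even. This symmetry feeds the comparison of the residual with the
deviation. -/
theorem IsDiffusion.map_neg_noise_one (hW : IsBrownianMotion W P)
    (hX : IsDiffusion A B ε x W P X) (hε : 0 ≤ ε) :
    P.map (fun ω => -noise A ε x (X ω) 1) = P.map fun ω => noise A ε x (X ω) 1 := by
  have hm : AEMeasurable (fun ω => noise A ε x (X ω) 1) P :=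
    (continuous_noise A ε x 1).measurable.comp_aemeasurable hX.aemeasurable
  have := Measure.isProbabilityMeasure_map hm
  have hm' : AEMeasurable (fun ω => -noise A ε x (X ω) 1) P := hm.neg
  have := Measure.isProbabilityMeasure_map hm'
  refine Measure.ext_of_charFun (funext fun u => ?_)
  have h : charFun (P.map (fun ω => -noise A ε x (X ω) 1)) u
      = charFun (P.map fun ω => noise A ε x (X ω) 1) (-u) := by
    rw [charFun_apply, charFun_apply, integral_map hm' (by fun_prop),
      integral_map hm (by fun_prop)]
    simp
  rw [h, hX.charFun_noise_one hW hε, hX.charFun_noise_one hW hε]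
  simp

/-! ### Full support of the law of the final position -/

theorem isOpenPosMeasure_stdGaussian (d : ℕ) :
    (stdGaussian (EuclideanSpace ℝ (Fin d))).IsOpenPosMeasure := by
  have h1 : (gaussianReal 0 1).IsOpenPosMeasure :=
    (gaussianReal_absolutelyContinuous' 0 one_ne_zero).isOpenPosMeasure
  rw [← map_pi_eq_stdGaussian]
  exact (PiLp.continuous_toLp 2 _).isOpenPosMeasure_map (WithLp.toLp_surjective 2)

open scoped MatrixOrder in
theorem isOpenPosMeasure_multivariateGaussian {d : ℕ} (μ : EuclideanSpace ℝ (Fin d))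
    {S : Matrix (Fin d) (Fin d) ℝ} (hS : S.PosSemidef) (hS' : IsUnit S) :
    (multivariateGaussian μ S).IsOpenPosMeasure := by
  have := isOpenPosMeasure_stdGaussian d
  have hsqrt : IsUnit (CFC.sqrt S) := by
    have h : CFC.sqrt S * CFC.sqrt S = S := CFC.sqrt_mul_sqrt_self S (ha := hS.nonneg)
    rw [← h] at hS'
    exact (Commute.refl _).isUnit_mul_iff.1 hS' |>.1
  have hmap : IsUnit (Matrix.toEuclideanCLM (n := Fin d) (𝕜 := ℝ) (CFC.sqrt S)) :=
    hsqrt.map (Matrix.toEuclideanCLM (n := Fin d) (𝕜 := ℝ))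
  obtain ⟨R, hR⟩ := hmap
  refine Continuous.isOpenPosMeasure_map (by fun_prop) fun v => ⟨R⁻¹.val (v - μ), ?_⟩
  have hv : R.val (R⁻¹.val (v - μ)) = v - μ :=
    congrArg (fun T : EuclideanSpace ℝ (Fin d) →L[ℝ] EuclideanSpace ℝ (Fin d) => T (v - μ))
      R.mul_inv
  rw [← hR, hv, add_sub_cancel]

theorem posSemidef_Gam (A : Matrix (Fin d) (Fin d) ℝ) (B : Matrix (Fin d) (Fin m) ℝ) (ε : ℝ) :
    (Gam A B ε 1).PosSemidef := by
  refine Matrix.PosSemidef.of_dotProduct_mulVec_nonneg ?_ fun v => ?_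
  · ext i j
    have h := inner_matCLM_Gam_comm A B ε 1 (EuclideanSpace.single i 1) (EuclideanSpace.single j 1)
    simp only [matCLM_apply, Matrix.toLpLin_apply, EuclideanSpace.inner_single_left] at h
    simpa using h.symm
  · have h := inner_matCLM_Gam A B ε 1 (WithLp.toLp 2 v) (WithLp.toLp 2 v)
    have h0 : 0 ≤ inner ℝ (WithLp.toLp 2 v) (matCLM (Gam A B ε 1) (WithLp.toLp 2 v)) := by
      rw [h]
      exact intervalIntegral.integral_nonneg zero_le_one fun s _ => real_inner_self_nonneg
    simpa [matCLM_apply, Matrix.toLpLin_apply, EuclideanSpace.inner_eq_star_dotProduct,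
      dotProduct_comm] using h0

/-- `X_1 = e^{εA} (x + N_1)`, where `N_1` is Gaussian with invertible covariance `ε Γ_1`. -/
theorem IsDiffusion.isOpenPosMeasure_map_eval_one (hAB : KalmanCondition A B)
    (hW : IsBrownianMotion W P) (hX : IsDiffusion A B ε x W P X) (hε : 0 < ε) :
    (P.map fun ω => X ω 1).IsOpenPosMeasure := by
  have hm : AEMeasurable (fun ω => noise A ε x (X ω) 1) P :=
    (continuous_noise A ε x 1).measurable.comp_aemeasurable hX.aemeasurable
  have := Measure.isProbabilityMeasure_map hm
  have hpos : (ε • Gam A B ε 1).PosSemidef := (posSemidef_Gam A B ε).smul hε.le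
  have hunit : IsUnit (ε • Gam A B ε 1) := by
    have := (isUnit_Gam hAB hε).smul (Units.mk0 ε hε.ne')
    exact this
  have hgauss : P.map (fun ω => noise A ε x (X ω) 1)
      = multivariateGaussian 0 (ε • Gam A B ε 1) := by
    refine Measure.ext_of_charFun (funext fun u => ?_)
    rw [hX.charFun_noise_one hW hε.le, charFun_multivariateGaussian hpos]
    congr 1
    simp only [matCLM_apply, Matrix.toLpLin_apply, EuclideanSpace.inner_eq_star_dotProduct,
      Matrix.smul_mulVec, dotProduct_smul]
    rw [dotProduct_comm]
    simp
    ring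
  have hopen : (P.map fun ω => noise A ε x (X ω) 1).IsOpenPosMeasure := by
    rw [hgauss]
    exact isOpenPosMeasure_multivariateGaussian 0 hpos hunit
  have hc : Continuous fun v => flow (matCLM A) ε (x + v) := by fun_prop
  have hcomp : P.map (fun ω => X ω 1)
      = (P.map fun ω => noise A ε x (X ω) 1).map fun v => flow (matCLM A) ε (x + v) := by
    rw [AEMeasurable.map_map_of_aemeasurable hc.measurable.aemeasurable hm]
    congr 1
    funext ω
    simpa using eval_eq_flow_noise A ε x (X ω) 1
  rw [hcomp]
  refine hc.isOpenPosMeasure_map fun v => ⟨flow (matCLM A) (-ε) v - x, ?_⟩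
  simp only [add_sub_cancel, flow_apply_flow_neg]

/-! ### Independence of the residual and the final noise -/

/-- The process `e^{-εtA} (w - φ^ε(w_1))_t`. -/
def centredNoise {d m : ℕ} (A : Matrix (Fin d) (Fin d) ℝ) (B : Matrix (Fin d) (Fin m) ℝ) (ε : ℝ)
    (x : EuclideanSpace ℝ (Fin d)) (w : PathSpace d) (t : I) : EuclideanSpace ℝ (Fin d) :=
  noise A ε x w t - matCLM (Gam A B ε t) (matCLM (Gam A B ε 1)⁻¹ (noise A ε x w 1))

theorem continuous_centredNoise (A : Matrix (Fin d) (Fin d) ℝ) (B : Matrix (Fin d) (Fin m) ℝ)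
    (ε : ℝ) (x : EuclideanSpace ℝ (Fin d)) (t : I) :
    Continuous fun w => centredNoise A B ε x w t := by
  have h1 := continuous_noise A ε x t
  have h2 := continuous_noise A ε x 1
  unfold centredNoise
  fun_prop

theorem matCLM_Gam_inv (hAB : KalmanCondition A B) (hε : 0 < ε) (v : EuclideanSpace ℝ (Fin d)) :
    matCLM (Gam A B ε 1) (matCLM (Gam A B ε 1)⁻¹ v) = v := by
  have h := Matrix.mul_nonsing_inv _ ((Matrix.isUnit_iff_isUnit_det _).1 (isUnit_Gam hAB hε))
  rw [← ContinuousLinearMap.comp_apply, ← matCLM_mul, h]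
  simp [matCLM_apply]

theorem inner_matCLM_Gam_inv_comm (hAB : KalmanCondition A B) (hε : 0 < ε)
    (u v : EuclideanSpace ℝ (Fin d)) :
    inner ℝ u (matCLM (Gam A B ε 1)⁻¹ v) = inner ℝ v (matCLM (Gam A B ε 1)⁻¹ u) := by
  have h := inner_matCLM_Gam_comm A B ε 1 (matCLM (Gam A B ε 1)⁻¹ u) (matCLM (Gam A B ε 1)⁻¹ v)
  rw [matCLM_Gam_inv hAB hε, matCLM_Gam_inv hAB hε] at h
  rw [real_inner_comm, ← h, real_inner_comm]

/-- The characteristic function of finitely many values of the centred noise, jointly with the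
final value of the noise, factorises. -/
theorem IsDiffusion.charFun_centredNoise (hAB : KalmanCondition A B)
    (hW : IsBrownianMotion W P) (hX : IsDiffusion A B ε x W P X) (hε : 0 < ε) {ι : Type*}
    [Fintype ι] (t : ι → I) (u : ι → EuclideanSpace ℝ (Fin d)) (v : EuclideanSpace ℝ (Fin d)) :
    ∫ ω, Complex.exp (((inner ℝ (noise A ε x (X ω) 1) v
        + ∑ j, inner ℝ (centredNoise A B ε x (X ω) (t j)) (u j) : ℝ) : ℂ) * Complex.I) ∂P
      = Complex.exp (-((ε / 2 * inner ℝ v (matCLM (Gam A B ε 1) v) : ℝ) : ℂ)) *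
        ∫ ω, Complex.exp (((∑ j, inner ℝ (centredNoise A B ε x (X ω) (t j)) (u j) : ℝ) : ℂ)
          * Complex.I) ∂P := by
  set G : ℝ → _ := fun r => matCLM (Gam A B ε r) with hG
  -- Moving `Γ_{t_j} Γ_1⁻¹` to the other side of the inner product turns the exponent into a linear
  -- functional of the noise at the times `t j` and `1`, with coefficient `v - p` at time `1`;
  -- `Option ι` adjoins that time. Since `Γ_1 p = ∑ Γ_{t_j} u_j`, the cross terms between `v` and
  -- `u` vanish from the quadratic form.
  set p : EuclideanSpace ℝ (Fin d) := ∑ j, matCLM (Gam A B ε 1)⁻¹ (G (t j) (u j)) with hp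
  let t' : Option ι → I := fun o => o.elim 1 t
  let u' : EuclideanSpace ℝ (Fin d) → Option ι → EuclideanSpace ℝ (Fin d) :=
    fun v o => o.elim (v - p) u
  have hlin : ∀ v ω, inner ℝ (noise A ε x (X ω) 1) v
      + ∑ j, inner ℝ (centredNoise A B ε x (X ω) (t j)) (u j)
      = ∑ o, inner ℝ (noise A ε x (X ω) (t' o)) (u' v o) := by
    intro v ω
    simp only [Fintype.sum_option, t', u', Option.elim_none, Option.elim_some, centredNoise,
      inner_sub_left, inner_sub_right, Finset.sum_sub_distrib, hp, inner_sum]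
    have : ∀ j, inner ℝ (matCLM (Gam A B ε (t j)) (matCLM (Gam A B ε 1)⁻¹ (noise A ε x (X ω) 1)))
        (u j) = inner ℝ (noise A ε x (X ω) 1) (matCLM (Gam A B ε 1)⁻¹ (G (t j) (u j))) := by
      intro j
      rw [real_inner_comm, inner_matCLM_Gam_comm, real_inner_comm, inner_matCLM_Gam_inv_comm hAB hε]
    simp only [this]
    ring
  have hGp : G 1 p = ∑ j, G (t j) (u j) := by
    simp only [hp, hG, map_sum, matCLM_Gam_inv hAB hε]
  have hquad : ∀ v, (∑ o, ∑ o', inner ℝ (u' v o)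
      (matCLM (Gam A B ε (min (t' o : ℝ) (t' o'))) (u' v o')))
      = inner ℝ v (G 1 v) + ((∑ j, ∑ l, inner ℝ (u j) (G (min (t j : ℝ) (t l)) (u l)))
        - inner ℝ p (G 1 p)) := by
    intro v
    have hmin1 : ∀ j, min (1 : ℝ) (t j) = t j := fun j => min_eq_right (t j).2.2
    have hmin2 : ∀ j, min (t j : ℝ) 1 = t j := fun j => min_eq_left (t j).2.2
    simp only [Fintype.sum_option, t', u', Option.elim_none, Option.elim_some, Set.Icc.coe_one,
      min_self, hmin1, hmin2, Finset.sum_add_distrib]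
    have e1 : ∑ j, inner ℝ (v - p) (matCLM (Gam A B ε (t j)) (u j)) = inner ℝ (v - p) (G 1 p) := by
      rw [hGp, inner_sum]
    have e2 : ∑ j, inner ℝ (u j) (matCLM (Gam A B ε (t j)) (v - p)) = inner ℝ (v - p) (G 1 p) := by
      rw [← e1]
      exact Finset.sum_congr rfl fun j _ => inner_matCLM_Gam_comm _ _ _ _ _ _
    rw [e1, e2]
    have e3 : inner ℝ p (matCLM (Gam A B ε 1) v) = inner ℝ v (matCLM (Gam A B ε 1) p) :=
      inner_matCLM_Gam_comm _ _ _ _ _ _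
    simp only [hG, map_sub, inner_sub_left, inner_sub_right, e3]
    ring
  have hv := hX.charFun_noise hW hε.le t' (u' v)
  -- Taking `v = 0` computes the factor that depends on `u` alone.
  have h0 := hX.charFun_noise hW hε.le t' (u' 0)
  simp only [← hlin, hquad] at hv h0
  simp only [inner_zero_right, inner_zero_left, zero_add] at h0
  rw [hv, h0, ← Complex.exp_add]
  congr 1
  push_cast
  ring

/-- It suffices to treat finitely many times, where independence is the factorisation of
characteristic functions; Riesz representation splits a functional on the product into `v` and the
`u j`. -/
theorem IsDiffusion.indepFun_centredNoise (hAB : KalmanCondition A B)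
    (hW : IsBrownianMotion W P) (hX : IsDiffusion A B ε x W P X) (hε : 0 < ε) :
    IndepFun (fun ω => noise A ε x (X ω) 1) (fun ω (t : I) => centredNoise A B ε x (X ω) t) P := by
  have hm1 : AEMeasurable (fun ω => noise A ε x (X ω) 1) P :=
    (continuous_noise A ε x 1).measurable.comp_aemeasurable hX.aemeasurable
  have hm2 : ∀ t, AEMeasurable (fun ω => centredNoise A B ε x (X ω) t) P := fun t =>
    (continuous_centredNoise A B ε x t).measurable.comp_aemeasurable hX.aemeasurable
  refine IndepFun.indepFun_process₀ hm1 hm2 fun J => ?_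
  have hm3 : AEMeasurable (fun ω (j : J) => centredNoise A B ε x (X ω) j) P :=
    aemeasurable_pi_lambda _ fun j => hm2 j
  rw [indepFun_iff_charFunDual_prod hm1 hm3]
  intro L
  classical
  let v : EuclideanSpace ℝ (Fin d) := (InnerProductSpace.toDual ℝ _).symm
    (L.comp (.inl ℝ _ _))
  let u : J → EuclideanSpace ℝ (Fin d) := fun j => (InnerProductSpace.toDual ℝ _).symm
    ((L.comp (.inr ℝ _ _)).comp
      (ContinuousLinearMap.single ℝ (fun _ : J => EuclideanSpace ℝ (Fin d)) j))
  have hv : ∀ y, L.comp (.inl ℝ _ _) y = inner ℝ y v := fun y => by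
    rw [real_inner_comm, InnerProductSpace.toDual_symm_apply]
  have hu : ∀ z, L.comp (.inr ℝ _ _) z = ∑ j, inner ℝ (z j) (u j) := fun z => by
    conv_lhs => rw [← Finset.univ_sum_single z]
    rw [map_sum]
    refine Finset.sum_congr rfl fun j _ => ?_
    rw [real_inner_comm, InnerProductSpace.toDual_symm_apply]
    rfl
  have hL : ∀ y z, L (y, z) = inner ℝ y v + ∑ j, inner ℝ (z j) (u j) := fun y z => by
    rw [← hv, ← hu, ContinuousLinearMap.comp_apply, ContinuousLinearMap.comp_apply, ← map_add]
    simp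
  have key := hX.charFun_centredNoise hAB hW hε (fun j : J => (j : I)) u v
  rw [← hX.charFun_noise_one hW hε.le, charFun_apply, integral_map hm1 (by fun_prop)] at key
  rw [charFunDual_apply, charFunDual_apply, charFunDual_apply,
    integral_map (hm1.prodMk hm3) (by fun_prop), integral_map hm1 (by fun_prop),
    integral_map hm3 (by fun_prop)]
  simp only [hL, hv, hu]
  exact key

theorem IsDiffusion.indepFun_noise_residual (hAB : KalmanCondition A B)
    (hW : IsBrownianMotion W P) (hX : IsDiffusion A B ε x W P X) (hε : 0 < ε) :
    IndepFun (fun ω => noise A ε x (X ω) 1) (fun ω => residual A B ε x (X ω)) P := by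
  rw [indepFun_pathSpace_iff]
  have h := (hX.indepFun_centredNoise hAB hW hε).comp (φ := id)
    (ψ := fun (z : I → EuclideanSpace ℝ (Fin d)) (t : I) => flow (matCLM A) (ε * t) (z t))
    measurable_id (measurable_pi_lambda _ fun t => by fun_prop)
  simp only [residual_apply]
  exact h

end

/-! ### The bridge kernel -/

section

variable {d m : ℕ} {A : Matrix (Fin d) (Fin d) ℝ} {B : Matrix (Fin d) (Fin m) ℝ} {ε : ℝ}
  {x : EuclideanSpace ℝ (Fin d)}

theorem continuous_phi (A : Matrix (Fin d) (Fin d) ℝ) (B : Matrix (Fin d) (Fin m) ℝ) (ε : ℝ)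
    (x : EuclideanSpace ℝ (Fin d)) : Continuous fun y => phi A B ε x y := by
  refine ContinuousMap.continuous_of_continuous_uncurry _ ?_
  have hG : Continuous fun p : (EuclideanSpace ℝ (Fin d)) × I =>
      matCLM (Gam A B ε p.2) (matCLM (Gam A B ε 1)⁻¹ (flow (matCLM A) (-ε) p.1 - x)) := by
    refine (PiLp.continuous_toLp 2 _).comp (Continuous.matrix_mulVec
      (A := fun p : EuclideanSpace ℝ (Fin d) × I => Gam A B ε p.2)
      (B := fun p : EuclideanSpace ℝ (Fin d) × I =>
        (matCLM (Gam A B ε 1)⁻¹ (flow (matCLM A) (-ε) p.1 - x)).ofLp) ?_ ?_)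
    · exact (continuous_Gam A B ε).comp (by fun_prop)
    · fun_prop
  have hfl : Continuous fun p : (EuclideanSpace ℝ (Fin d)) × I => flow (matCLM A) (ε * p.2) :=
    (continuous_flow (matCLM A)).comp (by fun_prop)
  have := hfl.clm_apply ((continuous_const (y := x)).add hG)
  refine this.congr fun p => ?_
  exact (phi_apply A B ε x p.1 p.2).symm

theorem continuous_residual (A : Matrix (Fin d) (Fin d) ℝ) (B : Matrix (Fin d) (Fin m) ℝ) (ε : ℝ)
    (x : EuclideanSpace ℝ (Fin d)) : Continuous (residual A B ε x) :=
  continuous_id.sub ((continuous_phi A B ε x).comp (continuous_eval_const 1))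

/-- The kernel which sends `y` to the law of `z + φ^ε(y)`, where `z` has law `ρ`. -/
def translateKernel (A : Matrix (Fin d) (Fin d) ℝ) (B : Matrix (Fin d) (Fin m) ℝ) (ε : ℝ)
    (x : EuclideanSpace ℝ (Fin d)) (ρ : Measure (PathSpace d)) :
    Kernel (EuclideanSpace ℝ (Fin d)) (PathSpace d) :=
  Kernel.map (Kernel.id ×ₖ Kernel.const _ ρ) fun p => p.2 + phi A B ε x p.1

theorem measurable_add_phi (A : Matrix (Fin d) (Fin d) ℝ) (B : Matrix (Fin d) (Fin m) ℝ) (ε : ℝ)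
    (x : EuclideanSpace ℝ (Fin d)) :
    Measurable fun p : EuclideanSpace ℝ (Fin d) × PathSpace d => p.2 + phi A B ε x p.1 :=
  (continuous_snd.add ((continuous_phi A B ε x).comp continuous_fst)).measurable

theorem translateKernel_apply (A : Matrix (Fin d) (Fin d) ℝ) (B : Matrix (Fin d) (Fin m) ℝ)
    (ε : ℝ) (x : EuclideanSpace ℝ (Fin d)) (ρ : Measure (PathSpace d)) [IsProbabilityMeasure ρ]
    (y : EuclideanSpace ℝ (Fin d)) :
    translateKernel A B ε x ρ y = ρ.map fun z => z + phi A B ε x y := by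
  rw [translateKernel, Kernel.map_apply _ (measurable_add_phi A B ε x), Kernel.prod_apply,
    Kernel.id_apply, Kernel.const_apply, Measure.dirac_prod,
    Measure.map_map (measurable_add_phi A B ε x) (by fun_prop)]
  rfl

/-- Two versions agree almost everywhere, and continuous functions of `y` that agree almost
everywhere for a measure of full support are equal. -/
theorem IsBridge.unique {Ω : Type*} [MeasurableSpace Ω] {P : Measure Ω} [IsProbabilityMeasure P]
    {X : Ω → PathSpace d} (hpos : (P.map fun ω => X ω 1).IsOpenPosMeasure)
    {κ η : Kernel (EuclideanSpace ℝ (Fin d)) (PathSpace d)} (hκ : IsBridge X P κ)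
    (hη : IsBridge X P η) : κ = η := by
  have := hκ.markov
  have := hη.markov
  have hm : AEMeasurable (fun ω => X ω 1) P := hκ.cond.aemeasurable_fst
  have := Measure.isProbabilityMeasure_map hm
  have hae : κ =ᵐ[P.map fun ω => X ω 1] η :=
    Kernel.ae_eq_of_compProd_eq (hκ.cond.map_eq.symm.trans hη.cond.map_eq)
  ext1 y
  refine ext_of_forall_integral_eq_of_IsFiniteMeasure fun f => ?_
  have hfeq : (fun y => ∫ w, f w ∂(κ y)) =ᵐ[P.map fun ω => X ω 1] fun y => ∫ w, f w ∂(η y) := by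
    filter_upwards [hae] with y hy
    rw [hy]
  exact congrFun (((hκ.cont f).ae_eq_iff_eq _ (hη.cont f)).1 hfeq) y

variable {Ω : Type*} [MeasurableSpace Ω] {P : Measure Ω}
  {W : I → Ω → EuclideanSpace ℝ (Fin m)} {X : Ω → PathSpace d}

/-- `X = R + φ(X_1)` with `R` independent of `X_1`, so conditioning merely freezes `X_1` at `y`;
weak continuity comes from continuity of `φ` in `y`. -/
theorem IsDiffusion.isBridge_translateKernel [IsProbabilityMeasure P] (hAB : KalmanCondition A B)
    (hW : IsBrownianMotion W P) (hX : IsDiffusion A B ε x W P X) (hε : 0 < ε) :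
    IsBridge X P (translateKernel A B ε x (P.map fun ω => residual A B ε x (X ω))) := by
  have hZm : AEMeasurable (fun ω => residual A B ε x (X ω)) P :=
    (continuous_residual A B ε x).measurable.comp_aemeasurable hX.aemeasurable
  have hX1 : AEMeasurable (fun ω => X ω 1) P :=
    (continuous_eval_const (F := PathSpace d) (1 : I)).measurable.comp_aemeasurable hX.aemeasurable
  have hρ := Measure.isProbabilityMeasure_map hZm
  set ρ := P.map fun ω => residual A B ε x (X ω) with hρdef
  have hmarkov : IsMarkovKernel (translateKernel A B ε x ρ) :=
    Kernel.IsMarkovKernel.map _ (measurable_add_phi A B ε x)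
  have hT : Measurable fun p : EuclideanSpace ℝ (Fin d) × PathSpace d =>
      (p.1, p.2 + phi A B ε x p.1) := measurable_fst.prodMk (measurable_add_phi A B ε x)
  have hind : IndepFun (fun ω => X ω 1) (fun ω => residual A B ε x (X ω)) P := by
    have h := (hX.indepFun_noise_residual hAB hW hε).comp
      (φ := fun v => flow (matCLM A) ε (x + v)) (ψ := id) (by fun_prop) measurable_id
    have heq : (fun v => flow (matCLM A) ε (x + v)) ∘ (fun ω => noise A ε x (X ω) 1)
        = fun ω => X ω 1 := by
      funext ω
      simpa using (eval_eq_flow_noise A ε x (X ω) 1).symm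
    rwa [heq] at h
  refine ⟨hmarkov, ⟨hX1.prodMk hX.aemeasurable, ?_⟩, fun f => ?_⟩
  · have hjoint := (indepFun_iff_map_prod_eq_prod_map_map hX1 hZm).1 hind
    have hXeq : (fun ω => (X ω 1, X ω)) = (fun p : EuclideanSpace ℝ (Fin d) × PathSpace d =>
        (p.1, p.2 + phi A B ε x p.1)) ∘ fun ω => (X ω 1, residual A B ε x (X ω)) := by
      funext ω
      simp [residual]
    have := Measure.isProbabilityMeasure_map hX1
    rw [hXeq, ← AEMeasurable.map_map_of_aemeasurable hT.aemeasurable (hX1.prodMk hZm), hjoint,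
      ← hρdef]
    ext s hs
    rw [Measure.map_apply hT hs, Measure.prod_apply (hT hs), Measure.compProd_apply hs]
    refine lintegral_congr fun y => ?_
    rw [translateKernel_apply, Measure.map_apply (by fun_prop) (measurable_prodMk_left hs)]
    rfl
  · have heq : ∀ y, ∫ w, f w ∂(translateKernel A B ε x ρ y)
        = ∫ z, f (z + phi A B ε x y) ∂ρ := fun y => by
      rw [translateKernel_apply, integral_map (by fun_prop)
        f.continuous.measurable.aestronglyMeasurable]
    simp only [heq]
    refine continuous_of_dominated (bound := fun _ => ‖f‖) (fun y => ?_)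
      (fun y => ae_of_all _ fun z => f.norm_coe_le_norm _) (integrable_const _)
      (ae_of_all _ fun z => ?_)
    · exact (f.continuous.comp (by fun_prop)).measurable.aestronglyMeasurable
    · exact f.continuous.comp (continuous_const.add (continuous_phi A B ε x))

theorem IsDiffusion.isBridge_iff [IsProbabilityMeasure P] (hAB : KalmanCondition A B)
    (hW : IsBrownianMotion W P) (hX : IsDiffusion A B ε x W P X) (hε : 0 < ε)
    {κ : Kernel (EuclideanSpace ℝ (Fin d)) (PathSpace d)} :
    IsBridge X P κ ↔ κ = translateKernel A B ε x (P.map fun ω => residual A B ε x (X ω)) := by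
  refine ⟨fun h => h.unique (hX.isOpenPosMeasure_map_eval_one hAB hW hε)
    (hX.isBridge_translateKernel hAB hW hε), ?_⟩
  rintro rfl
  exact hX.isBridge_translateKernel hAB hW hε

/-! ### Loops -/

theorem Gam_zero (A : Matrix (Fin d) (Fin d) ℝ) (B : Matrix (Fin d) (Fin m) ℝ) (ε : ℝ) :
    Gam A B ε 0 = 0 := by
  ext i j
  simp [Gam]

theorem IsDiffusion.residual_loop (hAB : KalmanCondition A B)
    (hW : IsBrownianMotion W P) (hX : IsDiffusion A B ε x W P X) (hε : 0 < ε) :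
    ∀ᵐ ω ∂P, residual A B ε x (X ω) 0 = 0 ∧ residual A B ε x (X ω) 1 = 0 := by
  filter_upwards [hX.inner_noise, hW.start] with ω hω hω0
  have hn : noise A ε x (X ω) 0 = 0 := by
    refine ext_inner_right ℝ fun u => ?_
    rw [hω, pathIntegral]
    simp [extend, hω0]
  constructor
  · rw [residual_apply, hn, Set.Icc.coe_zero, Gam_zero]
    simp [matCLM]
  · rw [residual_apply, Set.Icc.coe_one, matCLM_Gam_inv hAB hε, sub_self, map_zero]

/-- The retraction of the path space onto the loop space which subtracts the chord. -/
def subChord (w : PathSpace d) : LoopSpace d :=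
  ⟨⟨fun t => w t - ((1 - (t : ℝ)) • w 0 + (t : ℝ) • w 1), by fun_prop⟩, by simp, by simp⟩

theorem continuous_subChord : Continuous (subChord (d := d)) := by
  refine Continuous.subtype_mk (ContinuousMap.continuous_of_continuous_uncurry _ ?_) _
  have h : Continuous fun p : PathSpace d × I => p.1 p.2 := continuous_eval
  have h0 : Continuous fun p : PathSpace d × I => p.1 0 :=
    (continuous_eval_const (F := PathSpace d) (0 : I)).comp continuous_fst
  have h1 : Continuous fun p : PathSpace d × I => p.1 1 :=
    (continuous_eval_const (F := PathSpace d) (1 : I)).comp continuous_fst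
  have ht : Continuous fun p : PathSpace d × I => (p.2 : ℝ) := by fun_prop
  exact h.sub (((continuous_const.sub ht).smul h0).add (ht.smul h1))

theorem subChord_val_of_loop {w : PathSpace d} (h0 : w 0 = 0) (h1 : w 1 = 0) :
    (subChord w : PathSpace d) = w := by
  ext1 t
  simp [subChord, h0, h1]

/-! ### Convergence -/

/-- If `Y` is symmetric and independent of `Z`, then `Z` is no larger than `Z + ψ(Y)` in
probability, up to a factor of two. -/
theorem measure_le_norm_le_two_mul {V F : Type*} [MeasurableSpace V] [AddGroup V] [MeasurableNeg V]
    [NormedAddCommGroup F] [NormedSpace ℝ F] [MeasurableSpace F] [BorelSpace F]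
    [SecondCountableTopology F] [IsProbabilityMeasure P] {Y : Ω → V} {Z : Ω → F} {ψ : V → F}
    (hY : AEMeasurable Y P)
    (hZ : AEMeasurable Z P) (hind : IndepFun Y Z P) (hsymm : P.map (fun ω => -Y ω) = P.map Y)
    (hψ : Measurable ψ) (hodd : ∀ v, ψ (-v) = -ψ v) (δ : ℝ) :
    P {ω | δ ≤ ‖Z ω‖} ≤ 2 * P {ω | δ ≤ ‖Z ω + ψ (Y ω)‖} := by
  have hY' : AEMeasurable (fun ω => -Y ω) P := hY.neg
  have hind' : IndepFun (fun ω => -Y ω) Z P := hind.comp (φ := Neg.neg) (ψ := id)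
    measurable_neg measurable_id
  -- Hence `Z + ψ(Y)` and `Z - ψ(Y)` have the same law; as `Z` is their midpoint, one of them has
  -- norm at least `δ` whenever `Z` does.
  have hlaw : P.map (fun ω => (-Y ω, Z ω)) = P.map fun ω => (Y ω, Z ω) := by
    rw [(indepFun_iff_map_prod_eq_prod_map_map hY' hZ).1 hind',
      (indepFun_iff_map_prod_eq_prod_map_map hY hZ).1 hind, hsymm]
  have hS : MeasurableSet {p : V × F | δ ≤ ‖p.2 + ψ p.1‖} := by
    refine measurableSet_le measurable_const ?_
    exact (measurable_snd.add (hψ.comp measurable_fst)).norm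
  have heq : P {ω | δ ≤ ‖Z ω - ψ (Y ω)‖} = P {ω | δ ≤ ‖Z ω + ψ (Y ω)‖} := by
    have h1 := Measure.map_apply_of_aemeasurable (hY'.prodMk hZ) hS
    have h2 := Measure.map_apply_of_aemeasurable (hY.prodMk hZ) hS
    rw [hlaw, h2] at h1
    simpa [Set.preimage, hodd, sub_eq_add_neg] using h1.symm
  have hsub : {ω | δ ≤ ‖Z ω‖} ⊆ {ω | δ ≤ ‖Z ω + ψ (Y ω)‖} ∪ {ω | δ ≤ ‖Z ω - ψ (Y ω)‖} := by
    intro ω hω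
    by_contra hcon
    simp only [Set.mem_union, not_or, Set.mem_ofPred_eq, not_le] at hcon hω
    have h2 : (2 : ℝ) • Z ω = (Z ω + ψ (Y ω)) + (Z ω - ψ (Y ω)) := by
      rw [two_smul]
      abel
    have h3 := norm_add_le (Z ω + ψ (Y ω)) (Z ω - ψ (Y ω))
    rw [← h2, norm_smul, Real.norm_two] at h3
    linarith [hcon.1, hcon.2]
  calc P {ω | δ ≤ ‖Z ω‖} ≤ _ := measure_mono hsub
    _ ≤ _ := measure_union_le _ _
    _ = _ := by rw [heq, two_mul]

/-- The path `w_t - e^{εtA} x`, written as the residual plus a function of the final noise. -/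
def deviation (A : Matrix (Fin d) (Fin d) ℝ) (B : Matrix (Fin d) (Fin m) ℝ) (ε : ℝ)
    (x : EuclideanSpace ℝ (Fin d)) (w : PathSpace d) : PathSpace d :=
  residual A B ε x w + phi A B ε 0 (flow (matCLM A) ε (noise A ε x w 1))

/-- The terms with `Γ_t Γ_1⁻¹` cancel, so the deviation can be bounded without any control of
`Γ_1⁻¹`. -/
theorem deviation_apply (A : Matrix (Fin d) (Fin d) ℝ) (B : Matrix (Fin d) (Fin m) ℝ) (ε : ℝ)
    (x : EuclideanSpace ℝ (Fin d)) (w : PathSpace d) (t : I) :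
    deviation A B ε x w t = flow (matCLM A) (ε * t) (noise A ε x w t) := by
  rw [deviation, ContinuousMap.add_apply, residual_apply, phi_apply, flow_neg_apply_flow,
    ← map_add]
  congr 1
  rw [zero_add, sub_zero, sub_add_cancel]

theorem continuous_deviation (A : Matrix (Fin d) (Fin d) ℝ) (B : Matrix (Fin d) (Fin m) ℝ) (ε : ℝ)
    (x : EuclideanSpace ℝ (Fin d)) : Continuous (deviation A B ε x) :=
  (continuous_residual A B ε x).add ((continuous_phi A B ε 0).comp
    ((flow (matCLM A) ε).continuous.comp (continuous_noise A ε x 1)))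

theorem phi_zero_neg (A : Matrix (Fin d) (Fin d) ℝ) (B : Matrix (Fin d) (Fin m) ℝ) (ε : ℝ)
    (y : EuclideanSpace ℝ (Fin d)) : phi A B ε 0 (-y) = -phi A B ε 0 y := by
  ext1 t
  simp [phi_apply]

theorem IsDiffusion.measure_le_norm_residual_le [IsProbabilityMeasure P] (hAB : KalmanCondition A B)
    (hW : IsBrownianMotion W P) (hX : IsDiffusion A B ε x W P X) (hε : 0 < ε) (δ : ℝ) :
    P {ω | δ ≤ ‖residual A B ε x (X ω)‖} ≤ 2 * P {ω | δ ≤ ‖deviation A B ε x (X ω)‖} :=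
  measure_le_norm_le_two_mul (ψ := fun v => phi A B ε 0 (flow (matCLM A) ε v))
    ((continuous_noise A ε x 1).measurable.comp_aemeasurable hX.aemeasurable)
    ((continuous_residual A B ε x).measurable.comp_aemeasurable hX.aemeasurable)
    (hX.indepFun_noise_residual hAB hW hε) (hX.map_neg_noise_one hW hε.le)
    ((continuous_phi A B ε 0).comp (flow (matCLM A) ε).continuous).measurable
    (fun v => by rw [map_neg, phi_zero_neg]) δ

/-- The exceptional null set of the equation depends on `ε`, so the almost sure statement is made
along a sequence. On each good path the noise is at most `√ε` times the supremum of `W`, up to a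
constant. -/
theorem tendsto_deviation {X : ℝ → Ω → PathSpace d} (hW : IsBrownianMotion W P)
    (hX : ∀ ε : ℝ, 0 < ε → IsDiffusion A B ε x W P (X ε)) {e : ℕ → ℝ} (he0 : ∀ n, 0 < e n)
    (he : Tendsto e atTop (𝓝 0)) :
    ∀ᵐ ω ∂P, Tendsto (fun n => deviation A B (e n) x (X (e n) ω)) atTop (𝓝 0) := by
  obtain ⟨C, hC0, hC⟩ := exists_abs_pathIntegral_kernelCurve_le (matCLM A) (matCLM B)
  obtain ⟨K, hK⟩ := isCompact_Icc.exists_bound_of_continuousOn (s := Set.Icc (0 : ℝ) 1)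
    (continuous_flow (matCLM A)).continuousOn
  have hK0 : 0 ≤ K := (norm_nonneg _).trans (hK 0 (by norm_num))
  filter_upwards [ae_all_iff.2 fun n => (hX (e n) (he0 n)).inner_noise, hW.cont] with ω hω hωc
  have hwc : Continuous (extend W ω) := hωc.comp continuous_projIcc
  obtain ⟨S, hS⟩ := isCompact_Icc.exists_bound_of_continuousOn (s := Set.Icc (0 : ℝ) 1)
    hwc.continuousOn
  have hS0 : 0 ≤ S := (norm_nonneg _).trans (hS 0 (by norm_num))
  have hlim : Tendsto (fun n => K * (√(e n) * (C * S))) atTop (𝓝 0) := by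
    have := ((Real.continuous_sqrt.tendsto 0).comp he).mul_const (C * S)
    simpa using this.const_mul K
  refine squeeze_zero_norm' ?_ hlim
  filter_upwards [he.eventually (gt_mem_nhds zero_lt_one)] with n hn
  rw [ContinuousMap.norm_le _ (by positivity)]
  intro t
  have hmem : e n * t ∈ Set.Icc (0 : ℝ) 1 :=
    ⟨mul_nonneg (he0 n).le t.2.1, mul_le_one₀ hn.le t.2.1 t.2.2⟩
  rw [deviation_apply]
  refine (ContinuousLinearMap.le_opNorm _ _).trans ?_
  gcongr
  · exact hK _ hmem
  set v := noise A (e n) x (X (e n) ω) t with hv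
  -- The noise is tested against itself, `u = v`, to pass from scalar bounds to the norm.
  have h1 : ‖v‖ * ‖v‖ ≤ √(e n) * (C * S) * ‖v‖ := by
    rw [← real_inner_self_eq_norm_mul_norm, hv, hω n t, ← hv, mul_assoc]
    gcongr
    exact (le_abs_self _).trans (hC _ (he0 n).le hn.le v _ S hS t t.2)
  rcases (norm_nonneg v).eq_or_lt with h0 | h0
  · rw [← h0]
    positivity
  · exact le_of_mul_le_mul_right h1 h0

/-- The residual of the diffusion with parameter `ε`, extended by `0` to `ε ≤ 0`. -/
def residualProcess (A : Matrix (Fin d) (Fin d) ℝ) (B : Matrix (Fin d) (Fin m) ℝ)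
    (x : EuclideanSpace ℝ (Fin d)) (X : ℝ → Ω → PathSpace d) (ε : ℝ) (ω : Ω) : PathSpace d :=
  if 0 < ε then residual A B ε x (X ε ω) else 0

theorem aemeasurable_residualProcess {X : ℝ → Ω → PathSpace d}
    (hX : ∀ ε : ℝ, 0 < ε → IsDiffusion A B ε x W P (X ε)) (ε : ℝ) :
    AEMeasurable (residualProcess A B x X ε) P := by
  unfold residualProcess
  split_ifs with hε
  · exact (continuous_residual A B ε x).measurable.comp_aemeasurable (hX ε hε).aemeasurable
  · exact aemeasurable_const

theorem tendstoInMeasure_residualProcess [IsProbabilityMeasure P] (hAB : KalmanCondition A B)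
    {X : ℝ → Ω → PathSpace d}
    (hW : IsBrownianMotion W P) (hX : ∀ ε : ℝ, 0 < ε → IsDiffusion A B ε x W P (X ε)) :
    TendstoInMeasure P (residualProcess A B x X) (𝓝[>] 0) fun _ => 0 := by
  rw [tendstoInMeasure_iff_norm]
  intro δ hδ
  refine tendsto_of_seq_tendsto fun e he => ?_
  rw [tendsto_nhdsWithin_iff] at he
  -- A sequence tending to `0` from the right is only eventually positive, so its first `N` terms
  -- are dropped.
  obtain ⟨N, hN⟩ := eventually_atTop.1 he.2
  rw [← tendsto_add_atTop_iff_nat N]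
  have he0 : ∀ n, 0 < e (n + N) := fun n => hN _ (Nat.le_add_left _ _)
  have hdev := tendstoInMeasure_of_tendsto_ae (fun n =>
    ((continuous_deviation A B _ x).measurable.comp_aemeasurable
      (hX _ (he0 n)).aemeasurable).aestronglyMeasurable)
    (tendsto_deviation hW hX he0 ((tendsto_add_atTop_iff_nat N).2 he.1))
  rw [tendstoInMeasure_iff_norm] at hdev
  have hlim := ENNReal.Tendsto.const_mul (hdev δ hδ) (a := 2) (Or.inr ENNReal.ofNat_ne_top)
  rw [mul_zero] at hlim
  refine tendsto_of_tendsto_of_tendsto_of_le_of_le tendsto_const_nhds hlim (fun _ => zero_le)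
    fun n => ?_
  simp only [Function.comp_apply, residualProcess, if_pos (he0 n), sub_zero]
  exact (hX _ (he0 n)).measure_le_norm_residual_le hAB hW (he0 n) δ

end

end DiffusionBridge

end

/-! ### Laws on the loop space and their weak limit -/

theorem theorem1p1 {d m : ℕ} (A : Matrix (Fin d) (Fin d) ℝ) (B : Matrix (Fin d) (Fin m) ℝ)
    (hAB : DiffusionBridge.KalmanCondition A B)
    {Ω : Type*} [MeasurableSpace Ω] (P : Measure Ω) [IsProbabilityMeasure P]
    (W : unitInterval → Ω → EuclideanSpace ℝ (Fin m)) (hW : DiffusionBridge.IsBrownianMotion W P)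
    (x : EuclideanSpace ℝ (Fin d))
    (X : ℝ → Ω → DiffusionBridge.PathSpace d)
    (hX : ∀ ε : ℝ, 0 < ε → DiffusionBridge.IsDiffusion A B ε x W P (X ε)) :
    -- the path `φ^ε(y)` and the bridge laws are well defined
    (∀ ε : ℝ, 0 < ε → IsUnit (DiffusionBridge.Gam A B ε 1)) ∧
    (∀ ε : ℝ, 0 < ε →
      ∃! κ : Kernel (EuclideanSpace ℝ (Fin d)) (DiffusionBridge.PathSpace d),
        DiffusionBridge.IsBridge (X ε) P κ) ∧
    -- the laws `ν ε` of `z^ε(y) - φ^ε(y)` live on the loop space and converge there weakly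
    (∀ κ : ℝ → Kernel (EuclideanSpace ℝ (Fin d)) (DiffusionBridge.PathSpace d),
      (∀ ε : ℝ, 0 < ε → DiffusionBridge.IsBridge (X ε) P (κ ε)) →
      ∀ y : EuclideanSpace ℝ (Fin d),
        ∃ ν : ℝ → ProbabilityMeasure (DiffusionBridge.LoopSpace d),
          (∀ ε : ℝ, 0 < ε →
            Measure.map Subtype.val (ν ε : Measure (DiffusionBridge.LoopSpace d)) =
              Measure.map (fun z => z - DiffusionBridge.phi A B ε x y) (κ ε y)) ∧
          Tendsto ν (𝓝[>] (0 : ℝ)) (𝓝 (diracProba (DiffusionBridge.zeroLoop d)))) := by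
  refine ⟨fun ε hε => DiffusionBridge.isUnit_Gam hAB hε, fun ε hε => ?_, fun κ hκ y => ?_⟩
  · simp only [(hX ε hε).isBridge_iff hAB hW hε]
    exact existsUnique_eq
  have hm := DiffusionBridge.aemeasurable_residualProcess hX
  have hs : Measurable (DiffusionBridge.subChord (d := d)) :=
    DiffusionBridge.continuous_subChord.measurable
  have hconv := ((DiffusionBridge.tendstoInMeasure_residualProcess hAB hW hX
    ).tendstoInDistribution_of_aemeasurable hm aemeasurable_const).continuous_comp
    DiffusionBridge.continuous_subChord
  -- The residual is a loop only almost surely. Composing with the continuous retraction `subChord`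
  -- gives genuine loops, leaves the law unchanged, and preserves convergence in distribution.
  refine ⟨fun ε => ⟨P.map (DiffusionBridge.subChord ∘ DiffusionBridge.residualProcess A B x X ε),
    Measure.isProbabilityMeasure_map (hs.comp_aemeasurable (hm ε))⟩, fun ε hε => ?_, ?_⟩
  · have hZm : AEMeasurable (fun ω => DiffusionBridge.residual A B ε x (X ε ω)) P :=
      (DiffusionBridge.continuous_residual A B ε x).measurable.comp_aemeasurable
        (hX ε hε).aemeasurable
    have := Measure.isProbabilityMeasure_map hZm
    rw [((hX ε hε).isBridge_iff hAB hW hε).1 (hκ ε hε), DiffusionBridge.translateKernel_apply,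
      Measure.map_map (by fun_prop) (by fun_prop)]
    have hid : (fun z => z - DiffusionBridge.phi A B ε x y) ∘
        (fun z => z + DiffusionBridge.phi A B ε x y) = id := by
      funext z
      simp
    rw [hid, Measure.map_id, ProbabilityMeasure.coe_mk,
      AEMeasurable.map_map_of_aemeasurable measurable_subtype_coe.aemeasurable
        (hs.comp_aemeasurable (hm ε))]
    refine Measure.map_congr ?_
    filter_upwards [(hX ε hε).residual_loop hAB hW hε] with ω hω
    simp only [Function.comp_apply, DiffusionBridge.residualProcess, if_pos hε]
    exact DiffusionBridge.subChord_val_of_loop hω.1 hω.2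
  · have h0 : DiffusionBridge.subChord (0 : DiffusionBridge.PathSpace d)
        = DiffusionBridge.zeroLoop d :=
      Subtype.ext (DiffusionBridge.subChord_val_of_loop rfl rfl)
    have hdirac : diracProba (DiffusionBridge.zeroLoop d)
        = ⟨P.map (DiffusionBridge.subChord ∘ fun _ => 0),
          Measure.isProbabilityMeasure_map aemeasurable_const⟩ := by
      refine Subtype.ext ?_
      change Measure.dirac _ = P.map fun _ => DiffusionBridge.subChord 0
      rw [Measure.map_const, measure_univ, one_smul, h0]
    rw [hdirac]
    exact hconv.tendsto
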